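/- For each dimension $p$ let $k=k(p)\le p$ be an integer, $\sigma=\sigma(p)>0$ and $b_0=b_0(p)\in\mathbb{R}$. The support $S$ is uniform on the $k$-element subsets of $\{1,\dots,p\}$; the vector $\beta\in\mathbb{R}^p$ has $\beta_j=b_0$ for $j\in S$ and $\beta_j=0$ otherwise; the matrix $\mathbf{X}\in\mathbb{R}^{n\times p}$, $n=n(p)$, has i.i.d. $N(0,1)$ entries; the noise $Z^{(1)},\dots,Z^{(n)}$ is i.i.d. $N(0,\sigma^2)$; and $S$, $\mathbf{X}$, $Z$ are independent. The observations of the 1-bit model are $Y^{(i)}=\operatorname{sign}(\langle X^{(i)},\beta\rangle+Z^{(i)})$, $i=1,\dots,n$, where $X^{(i)}$ is the $i$-th row of $\mathbf{X}$ and $\operatorname{sign}(t)=1$ if $t\ge0$, $-1$ if $t<0$. A (measurable, deterministic) decoder, which may depend on $p,k,n,\sigma,b_0$, maps $(\mathbf{X},\mathbf{Y})$ to an estimate $\hat S$ of $S$; its error probability is $P_e=\mathbb{P}[\hat S\ne S]$. Let $W\sim N(0,1)$ and $Q(x)=\mathbb{P}[W\ge x]$. Suppose that, as $p\to\infty$,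 $k=\Theta(p)$ with $\log(p-k+1)=(1+o(1))\log p$ (for example, $k=\Theta(p)$ with $\limsup k/p<1$), $\sigma^2=\Theta(1)$, and $b_0^2=\Theta\big(\frac{\log p}{p}\big)$. Let $\eta\in(0,1)$ be a constant. Then $\mathbb{E}\big[W\log\frac{1-Q(W)}{Q(W)}\big]$ is finite (the integrand is integrable), and $$\frac{\log p}{I_1^*}\,(1-\eta)=\Theta\big(p\sqrt{\log p}\big),\qquad I_1^*:=\frac12\,\frac{b_0^2/\sigma^2}{\sqrt{2\pi k\,b_0^2/\sigma^2}}\;\mathbb{E}\Big[W\log\frac{1-Q(W)}{Q(W)}\Big].$$ Moreover, if $n\le\frac{\log p}{I_1^*}(1-\eta)$ for all sufficiently large $p$, then $P_e\to1$ as $p\to\infty$ for every sequence of decoders. -/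

import Mathlib

open MeasureTheory ProbabilityTheory Filter Topology Asymptotics

noncomputable section

/-- The Gaussian tail function `Q(x) = P[W ≥ x]` with `W ∼ N(0,1)`. -/
def gaussQ (x : ℝ) : ℝ := (gaussianReal 0 1).real (Set.Ici x)

/-- The function `w ↦ w log ((1 - Q(w)) / Q(w))`. -/
def wLogOdds (w : ℝ) : ℝ := w * Real.log ((1 - gaussQ w) / gaussQ w)

/-- `E[W log ((1 - Q(W)) / Q(W))]` with `W ∼ N(0,1)`. -/
def meanWLogOdds : ℝ := ∫ w, wLogOdds w ∂(gaussianReal 0 1)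

/-- `(1/2) (b₀²/σ²) / √(2 π k b₀²/σ²) · E[W log ((1 - Q(W)) / Q(W))]`. -/
def oneBitRate (k : ℕ) (σ b₀ : ℝ) : ℝ :=
  1 / 2 * ((b₀ ^ 2 / σ ^ 2) / Real.sqrt (2 * Real.pi * k * (b₀ ^ 2 / σ ^ 2))) * meanWLogOdds

/-- The sign with the convention that it equals `1` at `0`. -/
def oneBitSign (t : ℝ) : ℝ := if 0 ≤ t then 1 else -1

/-- The vector whose entries equal `b₀` on `s` and `0` off `s`. -/
def sparseVector {p : ℕ} (b₀ : ℝ) (s : Finset (Fin p)) : Fin p → ℝ :=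
  fun j => if j ∈ s then b₀ else 0

/-- The observations `Y⁽ⁱ⁾ = sign (⟨X⁽ⁱ⁾, β⟩ + Z⁽ⁱ⁾)`. -/
def oneBitObservation {n p : ℕ} (β : Fin p → ℝ) (x : Fin n → Fin p → ℝ) (z : Fin n → ℝ) :
    Fin n → ℝ :=
  fun i => oneBitSign (∑ j, x i j * β j + z i)

/-- The joint law of the independent triple `(S, X, Z)`: the support `S` is uniform on the
`k`-element subsets of the `p` indices, the `n × p` measurement matrix `X` has i.i.d. `N(0,1)`
entries, and the noise vector `Z` has `n` i.i.d. `N(0,σ²)` entries. -/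
def oneBitLaw (p k n : ℕ) (σ : ℝ) :
    Measure (Finset (Fin p) × (Fin n → Fin p → ℝ) × (Fin n → ℝ)) :=
  (uniformOn {s : Finset (Fin p) | s.card = k}).prod
    ((Measure.pi fun _ : Fin n => Measure.pi fun _ : Fin p => gaussianReal 0 1).prod
      (Measure.pi fun _ : Fin n => gaussianReal 0 (Real.toNNReal (σ ^ 2))))

/-- A decoder maps the pair `(X, Y)` to an estimate of the support. -/
abbrev SupportDecoder (p n : ℕ) : Type :=
  (Fin n → Fin p → ℝ) × (Fin n → ℝ) → Finset (Fin p)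

/-- The error probability `P_e = P[Ŝ ≠ S]` of a decoder in the 1-bit model whose nonzero
entries all equal `b₀`. -/
def oneBitErrorProb {p n : ℕ} (k : ℕ) (σ b₀ : ℝ) (dec : SupportDecoder p n) : ℝ :=
  (oneBitLaw p k n σ).real
    {ω | dec (ω.2.1, oneBitObservation (sparseVector b₀ ω.1) ω.2.1 ω.2.2) ≠ ω.1}

end

/-! A genie reveals all of the support but one element. Let T be the k - 1 revealed indices, j the
hidden one, A the contribution of the columns in T to a measurement, and τ² = σ² + b². If column j
is ignored, b X_j is only additional Gaussian noise, so the observations follow a reference law with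
support T and noise variance τ². Comparing likelihoods, the success probability is at most P(sum of
information densities > γ) plus e^γ times the reference probability that the decoder outputs `insert
j T`. The reference law does not depend on j, so these last probabilities sum to at most 1 over the
p - k + 1 candidates. Averaging over T and j bounds the success probability by P(sum > γ) + e^γ / (p
- k + 1): this is `one_sub_oneBitErrorProb_le`.

It remains to keep the sum below a γ slightly smaller than log p. The mean of one density is the
conditional mutual information E h(A/τ) - E h((A + bX)/σ), with h the entropy of a sign. Both terms
integrate h against centred Gaussian densities, and the difference of these densities is largest at
the origin. Hence the mean is at most a difference of two values of 1/√(2πv) times ∫ h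
(`integral_gaussEntropy_sub_le`), and ∫ h = E[W log((1 - Q(W))/Q(W))] by parts
(`integral_gaussEntropy`). Since k b²/σ² tends to infinity, this bound is I₁* (1 + o(1))
(`inv_sqrt_sub_inv_sqrt_le`).

The second moment of a density is controlled by a chi-squared divergence and is O(b²/σ²)
(`integral_sampleDensity_sq_le`, `meanGapVar_le`). With n = O(p √(log p)) and a margin of order log
p, Chebyshev's inequality leaves an error O(1/√(log p)). -/

/-! ### The Gaussian tail and its log-odds -/

lemma gaussQ_eq_integral (x : ℝ) : gaussQ x = ∫ u in Set.Ici x, gaussianPDFReal 0 1 u := by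
  rw [gaussQ, Measure.real, gaussianReal_apply_eq_integral _ one_ne_zero,
    ENNReal.toReal_ofReal]
  exact setIntegral_nonneg measurableSet_Ici fun u _ => gaussianPDFReal_nonneg _ _ _

lemma gaussQ_nonneg (x : ℝ) : 0 ≤ gaussQ x := measureReal_nonneg

lemma gaussQ_neg (x : ℝ) : gaussQ (-x) = 1 - gaussQ x := by
  have hn := nullSingletonClass_gaussianReal (μ := 0) (v := 1) one_ne_zero
  have h1 : gaussQ (-x) = (gaussianReal 0 1).real (Set.Iic x) := by
    have h := gaussianReal_map_neg (μ := 0) (v := 1)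
    rw [neg_zero] at h
    rw [gaussQ, ← h, map_measureReal_apply measurable_neg measurableSet_Ici, h]
    congr 1
    ext y
    simp
  have h2 : (gaussianReal 0 1).real (Set.Iic x) = (gaussianReal 0 1).real (Set.Iio x) :=
    measureReal_congr Iio_ae_eq_Iic.symm
  have h3 := probReal_compl_eq_one_sub (μ := gaussianReal 0 1) (measurableSet_Iio (a := x))
  rw [Set.compl_Iio] at h3
  rw [h1, h2]
  unfold gaussQ
  linarith

lemma continuous_gaussianPDFReal_std : Continuous (gaussianPDFReal 0 1) := by
  unfold gaussianPDFReal
  fun_prop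

lemma hasDerivAt_gaussQ (x : ℝ) : HasDerivAt gaussQ (-gaussianPDFReal 0 1 x) x := by
  have hi := integrable_gaussianPDFReal 0 1
  have h : gaussQ = fun y => gaussQ 0 - ∫ u in (0:ℝ)..y, gaussianPDFReal 0 1 u := by
    ext y
    rw [gaussQ_eq_integral, gaussQ_eq_integral, integral_Ici_eq_integral_Ioi,
      integral_Ici_eq_integral_Ioi, intervalIntegral.integral_Ioi_sub_Ioi' hi.integrableOn hi.integrableOn |>.symm]
    ring
  rw [h]
  have := intervalIntegral.integral_hasDerivAt_right (hi.intervalIntegrable (a := 0) (b := x))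
    (continuous_gaussianPDFReal_std.stronglyMeasurableAtFilter _ _)
    continuous_gaussianPDFReal_std.continuousAt
  simpa using this.const_sub (gaussQ 0)

lemma continuous_gaussQ : Continuous gaussQ :=
  continuous_iff_continuousAt.2 fun x => (hasDerivAt_gaussQ x).continuousAt

lemma gaussianPDFReal_std (x : ℝ) :
    gaussianPDFReal 0 1 x = (Real.sqrt (2 * Real.pi))⁻¹ * Real.exp (-x ^ 2 / 2) := by
  simp [gaussianPDFReal]

/-- Integrating the density over [x, x + 1] suffices. The constants are not sharp; what matters is
validity for every real x, so that log Q grows at most quadratically. -/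
lemma exp_le_gaussQ (x : ℝ) : Real.exp (-x ^ 2 - 3) ≤ gaussQ x := by
  have hi := integrable_gaussianPDFReal 0 1
  have h1 : ∫ u in Set.Icc x (x + 1), Real.exp (-x ^ 2 - 3) ≤
      ∫ u in Set.Icc x (x + 1), gaussianPDFReal 0 1 u := by
    refine setIntegral_mono_on (by simp) hi.integrableOn measurableSet_Icc fun u hu => ?_
    rw [gaussianPDFReal_std]
    have h2 : Real.exp (-1) ≤ (Real.sqrt (2 * Real.pi))⁻¹ := by
      rw [Real.exp_neg]
      gcongr
      rw [Real.sqrt_le_left (by positivity)]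
      have := Real.exp_one_gt_d9
      nlinarith [Real.pi_lt_d2]
    calc Real.exp (-x ^ 2 - 3) ≤ Real.exp (-1) * Real.exp (-u ^ 2 / 2) := by
          rw [← Real.exp_add]
          gcongr
          nlinarith [hu.1, hu.2, sq_nonneg (u - 2 * x), sq_nonneg (u-x), sq_nonneg (x - 1), sq_nonneg (x+1)]
      _ ≤ _ := by gcongr
  have h2 : ∫ u in Set.Icc x (x + 1), Real.exp (-x ^ 2 - 3) = Real.exp (-x ^ 2 - 3) := by simp
  rw [gaussQ_eq_integral, ← h2]
  refine h1.trans (setIntegral_mono_set hi.integrableOn ?_ ?_)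
  · exact Eventually.of_forall fun u => gaussianPDFReal_nonneg _ _ _
  · exact (Set.Icc_subset_Ici_self).eventuallyLE

lemma gaussQ_pos (x : ℝ) : 0 < gaussQ x := (Real.exp_pos _).trans_le (exp_le_gaussQ x)

lemma gaussQ_lt_one (x : ℝ) : gaussQ x < 1 := by
  have := gaussQ_pos (-x)
  rw [gaussQ_neg] at this
  linarith

lemma abs_log_gaussQ_le (x : ℝ) : |Real.log (gaussQ x)| ≤ x ^ 2 + 3 := by
  rw [abs_of_nonpos (Real.log_nonpos (gaussQ_nonneg x) (gaussQ_lt_one x).le)]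
  have := Real.log_le_log (Real.exp_pos _) (exp_le_gaussQ x)
  rw [Real.log_exp] at this
  linarith

lemma gaussQ_le_exp {x : ℝ} (hx : 0 ≤ x) : gaussQ x ≤ Real.exp (-x ^ 2 / 2) := by
  have h := measure_ge_le_exp_mul_mgf (μ := gaussianReal 0 1) (X := id) x hx
    (integrable_exp_mul_gaussianReal x)
  rw [mgf_id_gaussianReal] at h
  refine h.trans_eq ?_
  rw [← Real.exp_add]
  congr 1
  simp
  ring

lemma integrable_pow_gaussianReal (m : ℕ) (v : NNReal) :
    Integrable (fun w : ℝ => w ^ m) (gaussianReal 0 v) := by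
  have h := (memLp_id_gaussianReal (μ := 0) (v := v) (m : NNReal)).integrable_norm_pow'
  refine h.mono' (by fun_prop) (Eventually.of_forall fun w => ?_)
  simp

lemma measurable_wLogOdds : Measurable wLogOdds := by
  have := continuous_gaussQ.measurable
  unfold wLogOdds
  fun_prop

lemma wLogOdds_eq (w : ℝ) :
    wLogOdds w = w * (Real.log (1 - gaussQ w) - Real.log (gaussQ w)) := by
  rw [wLogOdds, Real.log_div (by linarith [gaussQ_lt_one w]) (gaussQ_pos w).ne']

lemma abs_wLogOdds_le (w : ℝ) : |wLogOdds w| ≤ 2 * w ^ 4 + 8 * w ^ 2 + 6 := by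
  have h1 := abs_log_gaussQ_le w
  have h2 := abs_log_gaussQ_le (-w)
  rw [gaussQ_neg, neg_sq] at h2
  rw [wLogOdds_eq, abs_mul]
  have h3 := abs_sub (Real.log (1 - gaussQ w)) (Real.log (gaussQ w))
  have h4 : |w| ≤ 1 + w ^ 2 := by nlinarith [sq_abs w, sq_nonneg (|w| - 1)]
  calc _ ≤ (1 + w ^ 2) * (2 * w ^ 2 + 6) := by
        gcongr
        linarith
    _ = _ := by ring

lemma integrable_wLogOdds : Integrable wLogOdds (gaussianReal 0 1) := by
  refine Integrable.mono' (g := fun w => 2 * w ^ 4 + 8 * w ^ 2 + 6) ?_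
    measurable_wLogOdds.aestronglyMeasurable (Eventually.of_forall abs_wLogOdds_le)
  exact (((integrable_pow_gaussianReal 4 1).const_mul 2).add
    ((integrable_pow_gaussianReal 2 1).const_mul 8)).add (integrable_const _)

/-! ### Entropy of a Gaussian sign and its integral -/

/-- The binary entropy of the sign of a unit-variance Gaussian with mean `x`. -/
noncomputable def gaussEntropy (x : ℝ) : ℝ := Real.binEntropy (gaussQ x)

lemma gaussEntropy_neg (x : ℝ) : gaussEntropy (-x) = gaussEntropy x := by
  rw [gaussEntropy, gaussQ_neg, Real.binEntropy_one_sub, gaussEntropy]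

lemma gaussEntropy_pos (x : ℝ) : 0 < gaussEntropy x :=
  Real.binEntropy_pos (gaussQ_pos x) (gaussQ_lt_one x)

lemma gaussEntropy_le_one (x : ℝ) : gaussEntropy x ≤ 1 :=
  Real.binEntropy_le_log_two.trans (by linarith [Real.log_two_lt_d9])

lemma continuous_gaussEntropy : Continuous gaussEntropy :=
  Real.binEntropy_continuous.comp continuous_gaussQ

/-- The term -q log q is at most 2√q because log(1/√q) ≤ 1/√q, and the other term is at most q ≤ √q.
A square-root bound keeps the Gaussian decay of Q. -/
lemma binEntropy_le_sqrt {q : ℝ} (h0 : 0 < q) (h1 : q < 1) :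
    Real.binEntropy q ≤ 3 * Real.sqrt q := by
  have hs := Real.sqrt_pos.2 h0
  have hss := Real.mul_self_sqrt h0.le
  have hs1 : Real.sqrt q ≤ 1 := Real.sqrt_le_one.2 h1.le
  have ha : Real.log q⁻¹ ≤ 2 * (Real.sqrt q)⁻¹ := by
    have := Real.log_le_sub_one_of_pos (inv_pos.2 hs)
    have h : Real.log q⁻¹ = 2 * Real.log (Real.sqrt q)⁻¹ := by
      rw [Real.log_inv, Real.log_inv, Real.log_sqrt h0.le]; ring
    rw [h]; linarith
  have hb := Real.log_le_sub_one_of_pos (inv_pos.2 (show 0 < 1 - q by linarith))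
  have hb' : (1 - q) * ((1 - q)⁻¹ - 1) = q := by
    rw [mul_sub, mul_inv_cancel₀ (by linarith)]; ring
  have hc : q * (2 * (Real.sqrt q)⁻¹) = 2 * Real.sqrt q := by
    rw [← hss]; field_simp; simp
  unfold Real.binEntropy
  have h3 := mul_le_mul_of_nonneg_left ha h0.le
  have h4 := mul_le_mul_of_nonneg_left hb (show 0 ≤ 1 - q by linarith)
  nlinarith

lemma gaussEntropy_le_exp (x : ℝ) : gaussEntropy x ≤ 3 * Real.exp (-(1 / 4) * x ^ 2) := by
  wlog hx : 0 ≤ x generalizing x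
  · have := this (-x) (by linarith)
    rwa [gaussEntropy_neg, neg_sq] at this
  refine (binEntropy_le_sqrt (gaussQ_pos x) (gaussQ_lt_one x)).trans ?_
  have h : Real.sqrt (gaussQ x) ≤ Real.sqrt (Real.exp (-(1 / 4) * x ^ 2) ^ 2) := by
    refine Real.sqrt_le_sqrt ((gaussQ_le_exp hx).trans_eq ?_)
    rw [← Real.exp_nat_mul]
    congr 1
    push_cast
    ring
  rw [Real.sqrt_sq (Real.exp_pos _).le] at h
  linarith

lemma integrable_gaussEntropy : Integrable gaussEntropy := by
  refine ((integrable_exp_neg_mul_sq (b := 1 / 4) (by norm_num)).const_mul 3).mono'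
    continuous_gaussEntropy.aestronglyMeasurable (Eventually.of_forall fun x => ?_)
  rw [Real.norm_eq_abs, abs_of_pos (gaussEntropy_pos x)]
  exact gaussEntropy_le_exp x

lemma integrable_mul_gaussEntropy : Integrable fun x => x * gaussEntropy x := by
  refine ((integrable_mul_exp_neg_mul_sq (b := 1 / 4) (by norm_num)).norm.const_mul 3).mono'
    (by have := continuous_gaussEntropy; fun_prop) (Eventually.of_forall fun x => ?_)
  rw [norm_mul, norm_mul, Real.norm_eq_abs (gaussEntropy x), abs_of_pos (gaussEntropy_pos x),
    Real.norm_eq_abs (Real.exp _), Real.abs_exp]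
  have := gaussEntropy_le_exp x
  nlinarith [norm_nonneg x]

lemma hasDerivAt_gaussEntropy (x : ℝ) : HasDerivAt gaussEntropy
    ((Real.log (1 - gaussQ x) - Real.log (gaussQ x)) * -gaussianPDFReal 0 1 x) x :=
  (Real.hasDerivAt_binEntropy (gaussQ_pos x).ne' (gaussQ_lt_one x).ne).comp x (hasDerivAt_gaussQ x)

lemma integrable_gaussianPDFReal_mul_iff (f : ℝ → ℝ) {v : NNReal} (hv : v ≠ 0) :
    Integrable f (gaussianReal 0 v) ↔ Integrable fun x => gaussianPDFReal 0 v x * f x := by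
  rw [gaussianReal_of_var_ne_zero _ hv, integrable_withDensity_iff_integrable_smul'
    (measurable_gaussianPDF _ _) (Eventually.of_forall fun x => gaussianPDF_lt_top)]
  simp [toReal_gaussianPDF]

/-- Integration by parts against the function x: the derivative of the entropy is minus the Gaussian
density times the log-odds. -/
lemma integral_gaussEntropy : ∫ x, gaussEntropy x = meanWLogOdds := by
  have h := integral_mul_deriv_eq_deriv_mul_of_integrable (u := fun x : ℝ => x)
    (u' := fun _ => (1 : ℝ)) (v := gaussEntropy)
    (v' := fun x => (Real.log (1 - gaussQ x) - Real.log (gaussQ x)) * -gaussianPDFReal 0 1 x)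
    (fun x _ => hasDerivAt_id x) (fun x _ => hasDerivAt_gaussEntropy x) ?_
    (by simpa [Pi.mul_def] using integrable_gaussEntropy) integrable_mul_gaussEntropy
  · rw [meanWLogOdds, integral_gaussianReal_eq_integral_smul one_ne_zero]
    simp only [one_mul] at h
    rw [← neg_eq_iff_eq_neg.2 h, ← integral_neg]
    congr 1
    ext x
    rw [wLogOdds_eq, smul_eq_mul]
    ring
  · have := ((integrable_gaussianPDFReal_mul_iff wLogOdds one_ne_zero).1 integrable_wLogOdds).neg
    convert this using 1
    ext x
    simp only [Pi.mul_apply, Pi.neg_apply, wLogOdds_eq]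
    ring

lemma meanWLogOdds_pos : 0 < meanWLogOdds := by
  rw [← integral_gaussEntropy, integral_pos_iff_support_of_nonneg
    (fun x => (gaussEntropy_pos x).le) integrable_gaussEntropy]
  have : Function.support gaussEntropy = Set.univ := by
    ext x
    simp [(gaussEntropy_pos x).ne']
  simp [this]

/-! ### Chi-squared control of log-likelihood ratios -/

/-- The chi-squared divergence does not increase when passing to a two-set partition. -/
lemma sq_setIntegral_sub_le {Ω : Type*} [MeasurableSpace Ω] {μ : Measure Ω} [IsProbabilityMeasure μ]
    {B : Set Ω} (hB : MeasurableSet B) {f : Ω → ℝ} (hf : MemLp f 2 μ) (hf1 : ∫ x, f x ∂μ = 1) :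
    (∫ x in B, f x ∂μ - μ.real B) ^ 2 ≤
      μ.real B * (1 - μ.real B) * (∫ x, f x ^ 2 ∂μ - 1) := by
  set b := μ.real B
  set k : Ω → ℝ := B.indicator fun _ => 1
  have hfi : Integrable f μ := hf.integrable (by norm_num)
  have hf2 : Integrable (fun x => f x ^ 2) μ := hf.integrable_sq
  have hk : Integrable k μ := (integrable_const 1).indicator hB
  have hfk : Integrable (fun x => f x * k x) μ := by
    refine (hfi.indicator hB).congr (Eventually.of_forall fun x => ?_)
    by_cases hx : x ∈ B <;> simp [k, hx]
  have hik : ∫ x, k x ∂μ = b := by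
    rw [integral_indicator hB]; simp [b]
  have hifk : ∫ x, f x * k x ∂μ = ∫ x in B, f x ∂μ := by
    rw [← integral_indicator hB]
    congr 1
    ext x
    by_cases hx : x ∈ B <;> simp [k, hx]
  -- This quadratic in `l` is the integral of ((f - 1) - l (1_B - b))². Its discriminant is
  -- therefore nonpositive, which is the claim in Cauchy–Schwarz form.
  have key : ∀ l : ℝ, 0 ≤ b * (1 - b) * (l * l) + (-2 * (∫ x in B, f x ∂μ - b)) * l +
      (∫ x, f x ^ 2 ∂μ - 1) := by
    intro l
    have h0 : 0 ≤ ∫ x, ((f x - 1) - l * (k x - b)) ^ 2 ∂μ := integral_nonneg fun x => sq_nonneg _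
    have h1 : ∀ x, ((f x - 1) - l * (k x - b)) ^ 2 = f x ^ 2 + (2 * l * b - 2) * f x
        - 2 * l * (f x * k x) + (2 * l + l ^ 2 - 2 * b * l ^ 2) * k x
        + (1 - 2 * l * b + l ^ 2 * b ^ 2) := by
      intro x
      by_cases hx : x ∈ B <;> simp [k, hx] <;> ring
    simp_rw [h1] at h0
    rw [integral_add, integral_add, integral_sub, integral_add, integral_const_mul,
      integral_const_mul, integral_const_mul, hik, hifk, hf1] at h0
    · simp at h0
      nlinarith
    · exact hf2
    · exact hfi.const_mul _
    · exact hf2.add (hfi.const_mul _)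
    · exact hfk.const_mul _
    · exact (hf2.add (hfi.const_mul _)).sub (hfk.const_mul _)
    · exact hk.const_mul _
    · exact ((hf2.add (hfi.const_mul _)).sub (hfk.const_mul _)).add (hk.const_mul _)
    · exact integrable_const _
  have := discrim_le_zero key
  unfold discrim at this
  nlinarith

/-- The integrand is the likelihood ratio of N(-d, 1) to N(0, 1). Its second moment exp(d²) is one
plus the chi-squared divergence of the two laws. -/
lemma gaussQ_add_eq_setIntegral (t d : ℝ) :
    gaussQ (t + d) = ∫ u in Set.Ici t, Real.exp (-d * u - d ^ 2 / 2) ∂(gaussianReal 0 1) := by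
  have h := gaussianReal_map_sub_const (μ := 0) (v := 1) d
  have h1 : gaussQ (t + d) = (gaussianReal (0 - d) 1).real (Set.Ici t) := by
    rw [gaussQ, ← h, map_measureReal_apply (by fun_prop) measurableSet_Ici]
    congr 1
    ext y
    simp
  rw [h1, ← integral_indicator measurableSet_Ici, integral_gaussianReal_eq_integral_smul one_ne_zero,
    Measure.real, gaussianReal_apply_eq_integral _ one_ne_zero, ENNReal.toReal_ofReal
    (setIntegral_nonneg measurableSet_Ici fun u _ => gaussianPDFReal_nonneg _ _ _),
    ← integral_indicator measurableSet_Ici]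
  congr 1
  ext u
  by_cases hu : u ∈ Set.Ici t
  · simp only [Set.indicator_of_mem hu, gaussianPDFReal, smul_eq_mul]
    rw [mul_assoc (Real.sqrt _)⁻¹, ← Real.exp_add]
    congr 2
    simp
    ring
  · simp [hu]

lemma memLp_exp_gaussianReal (d : ℝ) :
    MemLp (fun u => Real.exp (-d * u - d ^ 2 / 2)) 2 (gaussianReal 0 1) := by
  rw [memLp_two_iff_integrable_sq (by fun_prop)]
  have := (integrable_exp_mul_gaussianReal (μ := 0) (v := 1) (-2 * d)).mul_const (Real.exp (-d ^ 2))
  convert this using 1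
  ext u
  rw [← Real.exp_nat_mul, ← Real.exp_add]
  congr 1
  push_cast
  ring

lemma integral_exp_gaussianReal (d : ℝ) :
    ∫ u, Real.exp (-d * u - d ^ 2 / 2) ∂(gaussianReal 0 1) = 1 := by
  have h : mgf id (gaussianReal 0 1) (-d) = _ := congrFun mgf_id_gaussianReal (-d)
  simp only [Real.exp_sub, div_eq_mul_inv _ (Real.exp _)]
  rw [integral_mul_const]
  simp only [mgf, id] at h
  rw [h, ← div_eq_mul_inv, div_eq_one_iff_eq (Real.exp_pos _).ne']
  congr 1
  simp

lemma integral_exp_sq_gaussianReal (d : ℝ) :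
    ∫ u, Real.exp (-d * u - d ^ 2 / 2) ^ 2 ∂(gaussianReal 0 1) = Real.exp (d ^ 2) := by
  have h : mgf id (gaussianReal 0 1) (-2 * d) = _ := congrFun mgf_id_gaussianReal (-2 * d)
  have h2 : ∀ u : ℝ, Real.exp (-d * u - d ^ 2 / 2) ^ 2 =
      Real.exp (-2 * d * u) * Real.exp (-d ^ 2) := by
    intro u
    rw [← Real.exp_nat_mul, ← Real.exp_add]
    congr 1
    push_cast
    ring
  simp only [h2]
  rw [integral_mul_const]
  simp only [mgf, id] at h
  rw [h, ← Real.exp_add]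
  congr 1
  simp
  ring

lemma sq_gaussQ_sub_le (s t : ℝ) : (gaussQ s - gaussQ t) ^ 2 ≤
    gaussQ t * (1 - gaussQ t) * (Real.exp ((s - t) ^ 2) - 1) := by
  have h := sq_setIntegral_sub_le (measurableSet_Ici (a := t)) (memLp_exp_gaussianReal (s - t))
    (integral_exp_gaussianReal (s - t))
  rw [← gaussQ_add_eq_setIntegral, integral_exp_sq_gaussianReal, add_sub_cancel] at h
  exact h

/-- With x = y² and y ≥ 1, log y ≤ sinh(log y) gives log x ≤ y - 1/y. The case x < 1 follows from
the symmetry x ↦ 1/x. -/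
lemma log_sq_le {x : ℝ} (hx : 0 < x) : x * Real.log x ^ 2 ≤ (x - 1) ^ 2 := by
  wlog h1 : 1 ≤ x generalizing x
  · have h := this (inv_pos.2 hx) ((one_le_inv₀ hx).2 (not_le.1 h1).le)
    rw [Real.log_inv, neg_sq] at h
    have h2 := mul_le_mul_of_nonneg_left h (sq_nonneg x)
    have e1 : x ^ 2 * (x⁻¹ * Real.log x ^ 2) = x * Real.log x ^ 2 := by field_simp
    have e2 : x ^ 2 * (x⁻¹ - 1) ^ 2 = (x - 1) ^ 2 := by field_simp; ring
    rwa [e1, e2] at h2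
  set y := Real.sqrt x
  have hy : 0 < y := Real.sqrt_pos.2 hx
  have hxy : x = y ^ 2 := (Real.sq_sqrt hx.le).symm
  have hy1 : 1 ≤ y := Real.one_le_sqrt.2 h1
  have hl : 0 ≤ Real.log x := Real.log_nonneg h1
  have key : y * Real.log x ≤ x - 1 := by
    have h : Real.log x ≤ y - y⁻¹ := by
      have := Real.self_le_sinh_iff.2 (Real.log_nonneg hy1)
      rw [Real.sinh_log hy] at this
      rw [hxy, Real.log_pow]
      push_cast
      linarith
    have h2 := mul_le_mul_of_nonneg_left h hy.le
    rw [mul_sub, mul_inv_cancel₀ hy.ne', ← pow_two, ← hxy] at h2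
    exact h2
  have := pow_le_pow_left₀ (by positivity) key 2
  rw [mul_pow, ← hxy] at this
  exact this

lemma mul_log_sub_log_sq_le {q r : ℝ} (hq : 0 < q) (hr : 0 < r) :
    q * (Real.log q - Real.log r) ^ 2 ≤ (q - r) ^ 2 / r := by
  have h := log_sq_le (div_pos hq hr)
  rw [Real.log_div hq.ne' hr.ne'] at h
  have h2 := mul_le_mul_of_nonneg_left h hr.le
  have e1 : r * (q / r * (Real.log q - Real.log r) ^ 2) = q * (Real.log q - Real.log r) ^ 2 := by
    field_simp
  have e2 : r * (q / r - 1) ^ 2 = (q - r) ^ 2 / r := by field_simp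
  rwa [e1, e2] at h2

/-- Second moment of the log-likelihood ratio of the signs of two unit-variance Gaussians. -/
lemma logRatio_sq_le (s t : ℝ) :
    gaussQ (-s) * (Real.log (gaussQ (-s)) - Real.log (gaussQ (-t))) ^ 2 +
      gaussQ s * (Real.log (gaussQ s) - Real.log (gaussQ t)) ^ 2 ≤ Real.exp ((s - t) ^ 2) - 1 := by
  have h1 := mul_log_sub_log_sq_le (gaussQ_pos (-s)) (gaussQ_pos (-t))
  have h2 := mul_log_sub_log_sq_le (gaussQ_pos s) (gaussQ_pos t)
  have h3 := sq_gaussQ_sub_le s t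
  have ht := gaussQ_pos t
  have ht' : 0 < 1 - gaussQ t := by linarith [gaussQ_lt_one t]
  refine (add_le_add h1 h2).trans ?_
  -- The two terms add up to the chi-squared divergence of two Bernoulli laws, which
  -- `sq_gaussQ_sub_le` controls.
  have e : (gaussQ (-s) - gaussQ (-t)) ^ 2 / gaussQ (-t) + (gaussQ s - gaussQ t) ^ 2 / gaussQ t =
      (gaussQ s - gaussQ t) ^ 2 / (gaussQ t * (1 - gaussQ t)) := by
    rw [gaussQ_neg s, gaussQ_neg t]
    field_simp
    ring
  rw [e, div_le_iff₀ (mul_pos ht ht')]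
  linarith

/-! ### Comparison of centred Gaussian laws -/

/-- The right side is the difference at the origin. The smaller variance has the larger peak and the
smaller exponential factor, so the difference is at most the gap between the peaks times a factor at
most 1. -/
lemma gaussianPDFReal_sub_le {v w : NNReal} (hv : 0 < v) (hvw : v ≤ w) (x : ℝ) :
    gaussianPDFReal 0 v x - gaussianPDFReal 0 w x ≤
      (Real.sqrt (2 * Real.pi * v))⁻¹ - (Real.sqrt (2 * Real.pi * w))⁻¹ := by
  have hv' : (0 : ℝ) < v := hv
  have hw' : (v : ℝ) ≤ w := hvw
  have h1 : Real.exp (-(x - 0) ^ 2 / (2 * v)) ≤ Real.exp (-(x - 0) ^ 2 / (2 * w)) := by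
    rw [Real.exp_le_exp, neg_div, neg_div, neg_le_neg_iff]
    gcongr
  have h2 : Real.exp (-(x - 0) ^ 2 / (2 * v)) ≤ 1 := by
    rw [Real.exp_le_one_iff, neg_div, neg_nonpos]
    positivity
  have h3 : (Real.sqrt (2 * Real.pi * w))⁻¹ ≤ (Real.sqrt (2 * Real.pi * v))⁻¹ := by
    gcongr
  have h4 : 0 ≤ (Real.sqrt (2 * Real.pi * w))⁻¹ := by positivity
  unfold gaussianPDFReal
  nlinarith [mul_le_mul_of_nonneg_left h1 h4, mul_le_mul_of_nonneg_left h2 (sub_nonneg.2 h3)]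

lemma integrable_gaussEntropy_comp {Ω : Type*} [MeasurableSpace Ω] {μ : Measure Ω}
    [IsProbabilityMeasure μ] {f : Ω → ℝ} (hf : Measurable f) :
    Integrable (fun x => gaussEntropy (f x)) μ := by
  refine (integrable_const (1 : ℝ)).mono'
    (continuous_gaussEntropy.measurable.comp hf).aestronglyMeasurable
    (Eventually.of_forall fun x => ?_)
  rw [Real.norm_eq_abs, abs_of_pos (gaussEntropy_pos _)]
  exact gaussEntropy_le_one _

lemma integral_gaussEntropy_sub_le {v w : NNReal} (hv : 0 < v) (hvw : v ≤ w) :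
    ∫ x, gaussEntropy x ∂(gaussianReal 0 v) - ∫ x, gaussEntropy x ∂(gaussianReal 0 w) ≤
      ((Real.sqrt (2 * Real.pi * v))⁻¹ - (Real.sqrt (2 * Real.pi * w))⁻¹) * meanWLogOdds := by
  have hw : 0 < w := hv.trans_le hvw
  have hi : ∀ u : NNReal, u ≠ 0 → Integrable fun x => gaussianPDFReal 0 u x * gaussEntropy x :=
    fun u hu => (integrable_gaussianPDFReal_mul_iff _ hu).1 (integrable_gaussEntropy_comp measurable_id)
  rw [integral_gaussianReal_eq_integral_smul hv.ne', integral_gaussianReal_eq_integral_smul hw.ne',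
    ← integral_gaussEntropy, ← integral_const_mul]
  simp only [smul_eq_mul]
  rw [← integral_sub (hi v hv.ne') (hi w hw.ne')]
  refine integral_mono ((hi v hv.ne').sub (hi w hw.ne')) (integrable_gaussEntropy.const_mul _)
    fun x => ?_
  simp only [← sub_mul]
  exact mul_le_mul_of_nonneg_right (gaussianPDFReal_sub_le hv hvw x) (gaussEntropy_pos x).le

/-- The integral equals (1 - 2v)^(-1/2). Requiring v ≤ 1/4 stays away from the singularity at 1/2
and permits a linear bound. -/
lemma integrable_and_integral_exp_sq_gaussianReal_le {v : NNReal} (hv : 0 < v)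
    (hv4 : (v : ℝ) ≤ 1 / 4) :
    Integrable (fun x => Real.exp (x ^ 2)) (gaussianReal 0 v) ∧
      ∫ x, Real.exp (x ^ 2) ∂(gaussianReal 0 v) ≤ 1 + 2 * v := by
  have hv' : (0 : ℝ) < v := hv
  set b : ℝ := 1 / (2 * v) - 1
  have hb : 0 < b := by
    have : 2 ≤ 1 / (2 * (v : ℝ)) := by rw [le_div_iff₀ (by positivity)]; linarith
    simp only [b]; linarith
  have e : ∀ x : ℝ, gaussianPDFReal 0 v x * Real.exp (x ^ 2) =
      (Real.sqrt (2 * Real.pi * v))⁻¹ * Real.exp (-b * x ^ 2) := by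
    intro x
    rw [gaussianPDFReal, mul_assoc, ← Real.exp_add]
    congr 2
    simp only [b]
    field_simp
    ring
  constructor
  · rw [integrable_gaussianPDFReal_mul_iff _ hv.ne']
    simp_rw [e]
    exact (integrable_exp_neg_mul_sq hb).const_mul _
  · rw [integral_gaussianReal_eq_integral_smul hv.ne']
    simp_rw [smul_eq_mul, e]
    rw [integral_const_mul, integral_gaussian, ← Real.sqrt_inv, ← Real.sqrt_mul (by positivity)]
    apply Real.sqrt_le_iff.2 ⟨by positivity, _⟩
    have e2 : (2 * Real.pi * v)⁻¹ * (Real.pi / b) = (1 - 2 * (v : ℝ))⁻¹ := by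
      have : b = (1 - 2 * v) / (2 * v) := by simp only [b]; field_simp
      rw [this]
      have : 1 - 2 * (v : ℝ) ≠ 0 := by linarith
      field_simp
    rw [e2, inv_le_comm₀ (by linarith) (by positivity), inv_le_iff_one_le_mul₀ (by positivity)]
    nlinarith [mul_pos hv' hv', mul_nonneg hv'.le (sub_nonneg.2 hv4), mul_nonneg (mul_pos hv' hv').le (sub_nonneg.2 hv4)]

/-! ### Averaging signs over Gaussian noise -/

lemma gaussianReal_prod_map_linear (v w : NNReal) (l m : ℝ) :
    ((gaussianReal 0 v).prod (gaussianReal 0 w)).map (fun q => l * q.1 + m * q.2) =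
      gaussianReal 0 (Real.toNNReal (l ^ 2 * v + m ^ 2 * w)) := by
  have h := gaussianReal_add_gaussianReal_of_indepFun
    (P := (gaussianReal 0 v).prod (gaussianReal 0 w)) (X := fun q => l * q.1) (Y := fun q => m * q.2)
    (m₁ := 0) (m₂ := 0) (v₁ := Real.toNNReal (l ^ 2) * v) (v₂ := Real.toNNReal (m ^ 2) * w)
    (indepFun_prod (by fun_prop) (by fun_prop)) ?_ ?_
  · rw [add_zero] at h
    rw [show (fun q : ℝ × ℝ => l * q.1 + m * q.2) =
      (fun q => l * q.1) + fun q => m * q.2 from rfl, h]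
    congr 1
    rw [Real.toNNReal_add (by positivity) (by positivity), Real.toNNReal_mul (sq_nonneg _),
      Real.toNNReal_mul (sq_nonneg _), Real.toNNReal_coe, Real.toNNReal_coe]
  · rw [show (fun q : ℝ × ℝ => l * q.1) = (fun x => l * x) ∘ Prod.fst from rfl,
      ← Measure.map_map (by fun_prop) (by fun_prop), Measure.map_fst_prod]
    simp only [measure_univ, one_smul, gaussianReal_map_const_mul, mul_zero]
    congr 2
    exact (Real.toNNReal_of_nonneg (sq_nonneg l)).symm
  · rw [show (fun q : ℝ × ℝ => m * q.2) = (fun x => m * x) ∘ Prod.snd from rfl,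
      ← Measure.map_map (by fun_prop) (by fun_prop), Measure.map_snd_prod]
    simp only [measure_univ, one_smul, gaussianReal_map_const_mul, mul_zero]
    congr 2
    exact (Real.toNNReal_of_nonneg (sq_nonneg m)).symm

lemma gaussianReal_nonneg_add {τ : ℝ} (hτ : 0 < τ) (a : ℝ) :
    (gaussianReal 0 (Real.toNNReal (τ ^ 2))).real {z | 0 ≤ a + z} = gaussQ (-(a / τ)) := by
  have h : gaussianReal 0 (Real.toNNReal (τ ^ 2)) = (gaussianReal 0 1).map (fun x => τ * x) := by
    rw [gaussianReal_map_const_mul, mul_zero, mul_one]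
    congr 1
    exact Real.toNNReal_of_nonneg (sq_nonneg τ)
  rw [h, map_measureReal_apply (by fun_prop)
    (measurableSet_le measurable_const (by fun_prop)), gaussQ]
  congr 1
  ext x
  simp only [Set.mem_preimage, Set.mem_ofPred_eq, Set.mem_Ici, ← neg_div, div_le_iff₀ hτ]
  constructor <;> intro h <;> linarith

/-- Averaging a Gaussian tail probability over a Gaussian shift increases the variance. -/
lemma integral_gaussQ_add_mul {σ : ℝ} (hσ : 0 < σ) (a b : ℝ) :
    ∫ x, gaussQ (-((a + b * x) / σ)) ∂(gaussianReal 0 1) =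
      gaussQ (-(a / Real.sqrt (σ ^ 2 + b ^ 2))) := by
  have hpos : 0 < σ ^ 2 + b ^ 2 := by positivity
  rw [← gaussianReal_nonneg_add (Real.sqrt_pos.2 hpos), Real.sq_sqrt hpos.le]
  have hm := gaussianReal_prod_map_linear 1 (Real.toNNReal (σ ^ 2)) b 1
  have hv : Real.toNNReal (b ^ 2 * (1 : NNReal) + 1 ^ 2 * (Real.toNNReal (σ ^ 2))) =
      Real.toNNReal (σ ^ 2 + b ^ 2) := by
    congr 1
    rw [Real.coe_toNNReal _ (sq_nonneg _)]
    simp [add_comm]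
  have hS : MeasurableSet {z : ℝ | 0 ≤ a + z} := measurableSet_le measurable_const (by fun_prop)
  rw [← hv, ← hm, map_measureReal_apply (by fun_prop) hS, Measure.real,
    Measure.prod_apply (hS.preimage (by fun_prop)), ← integral_toReal
    (measurable_measure_prodMk_left (hS.preimage (by fun_prop))).aemeasurable
    (Eventually.of_forall fun x => measure_lt_top _ _)]
  congr 1
  ext x
  rw [← gaussianReal_nonneg_add hσ, Measure.real]
  congr 2
  ext z
  simp [add_assoc]

lemma measurable_oneBitSign : Measurable oneBitSign :=
  Measurable.ite measurableSet_Ici measurable_const measurable_const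

/-- Only the values of `f` at 1 and -1 matter, so measurability and integrability of such
compositions need no hypothesis on `f`. -/
lemma comp_oneBitSign_eq (f : ℝ → ℝ) (t : ℝ) : f (oneBitSign t) =
    {t : ℝ | 0 ≤ t}.indicator (fun _ => f 1) t + {t : ℝ | 0 ≤ t}ᶜ.indicator (fun _ => f (-1)) t := by
  unfold oneBitSign
  by_cases h : 0 ≤ t
  · simp [h]
  · simp [h]

lemma measurable_comp_oneBitSign (f : ℝ → ℝ) : Measurable fun t => f (oneBitSign t) := by
  have hS : MeasurableSet {t : ℝ | 0 ≤ t} := measurableSet_Ici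
  simp_rw [comp_oneBitSign_eq f]
  exact (measurable_const.indicator hS).add (measurable_const.indicator hS.compl)

lemma integrable_comp_oneBitSign {Ω : Type*} [MeasurableSpace Ω] {μ : Measure Ω}
    [IsFiniteMeasure μ] (f : ℝ → ℝ) {g : Ω → ℝ} (hg : Measurable g) :
    Integrable (fun ω => f (oneBitSign (g ω))) μ := by
  refine (integrable_const (|f 1| + |f (-1)|)).mono'
    ((measurable_comp_oneBitSign f).comp hg).aestronglyMeasurable (Eventually.of_forall fun ω => ?_)
  rw [Real.norm_eq_abs]
  unfold oneBitSign
  split_ifs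
  · linarith [abs_nonneg (f (-1))]
  · linarith [abs_nonneg (f 1)]

lemma integral_comp_oneBitSign {σ : ℝ} (hσ : 0 < σ) (f : ℝ → ℝ) (a : ℝ) :
    ∫ z, f (oneBitSign (a + z)) ∂(gaussianReal 0 (Real.toNNReal (σ ^ 2))) =
      gaussQ (-(a / σ)) * f 1 + gaussQ (a / σ) * f (-1) := by
  have hS : MeasurableSet {z : ℝ | 0 ≤ a + z} := measurableSet_le measurable_const (by fun_prop)
  have h : ∀ z, f (oneBitSign (a + z)) = {z : ℝ | 0 ≤ a + z}.indicator (fun _ => f 1) z +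
      {z : ℝ | 0 ≤ a + z}ᶜ.indicator (fun _ => f (-1)) z := fun z => comp_oneBitSign_eq f (a + z)
  simp_rw [h]
  rw [integral_add ((integrable_const _).indicator hS) ((integrable_const _).indicator hS.compl),
    integral_indicator hS, integral_indicator hS.compl, setIntegral_const, setIntegral_const,
    probReal_compl_eq_one_sub hS, gaussianReal_nonneg_add hσ, gaussQ_neg]
  simp

/-! ### Mean and second moment of the information density -/

/-- The information density of one sign `y` between unit-variance Gaussians with means `s`, `t`. -/
noncomputable def infoDensity (s t y : ℝ) : ℝ :=
  Real.log (gaussQ (-(y * s))) - Real.log (gaussQ (-(y * t)))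

/-- The information density of one measurement, as a function of the contribution `a` of the
revealed part of the support, the entry `x` of the hidden column, and the noise `z`. -/
noncomputable def sampleDensity (σ b : ℝ) (ω : (ℝ × ℝ) × ℝ) : ℝ :=
  infoDensity ((ω.1.1 + b * ω.1.2) / σ) (ω.1.1 / Real.sqrt (σ ^ 2 + b ^ 2))
    (oneBitSign (ω.1.1 + b * ω.1.2 + ω.2))

lemma measurable_sampleDensity (σ b : ℝ) : Measurable (sampleDensity σ b) := by
  have h1 := continuous_gaussQ.measurable
  have h2 := measurable_oneBitSign
  unfold sampleDensity infoDensity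
  fun_prop

/-- The variance of the difference of the two normalised means. -/
noncomputable def meanGapVar (V σ b : ℝ) : ℝ :=
  (σ⁻¹ - (Real.sqrt (σ ^ 2 + b ^ 2))⁻¹) ^ 2 * V + (b / σ) ^ 2

section
variable {σ b : ℝ} {V : NNReal}

lemma integral_sampleDensity_sq_noise_le (hσ : 0 < σ) (q : ℝ × ℝ) :
    ∫ z, sampleDensity σ b (q, z) ^ 2 ∂(gaussianReal 0 (Real.toNNReal (σ ^ 2))) ≤
      Real.exp (((σ⁻¹ - (Real.sqrt (σ ^ 2 + b ^ 2))⁻¹) * q.1 + b / σ * q.2) ^ 2) - 1 := by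
  have h := integral_comp_oneBitSign hσ (fun y => infoDensity ((q.1 + b * q.2) / σ)
    (q.1 / Real.sqrt (σ ^ 2 + b ^ 2)) y ^ 2) (q.1 + b * q.2)
  simp only [sampleDensity]
  rw [h]
  have h2 := logRatio_sq_le ((q.1 + b * q.2) / σ) (q.1 / Real.sqrt (σ ^ 2 + b ^ 2))
  simp only [infoDensity, one_mul, neg_mul, neg_neg]
  refine h2.trans_eq ?_
  congr 3
  ring

lemma integrable_exp_meanGap (hσ : 0 < σ) (hb : b ≠ 0) (h4 : meanGapVar V σ b ≤ 1 / 4) :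
    Integrable (fun q : ℝ × ℝ =>
        Real.exp (((σ⁻¹ - (Real.sqrt (σ ^ 2 + b ^ 2))⁻¹) * q.1 + b / σ * q.2) ^ 2))
        ((gaussianReal 0 V).prod (gaussianReal 0 1)) ∧
      ∫ q : ℝ × ℝ, Real.exp (((σ⁻¹ - (Real.sqrt (σ ^ 2 + b ^ 2))⁻¹) * q.1 + b / σ * q.2) ^ 2)
        ∂((gaussianReal 0 V).prod (gaussianReal 0 1)) ≤ 1 + 2 * meanGapVar V σ b := by
  have hm := gaussianReal_prod_map_linear V 1 (σ⁻¹ - (Real.sqrt (σ ^ 2 + b ^ 2))⁻¹) (b / σ)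
  simp only [NNReal.coe_one, mul_one] at hm
  have h0 : 0 < meanGapVar V σ b := by unfold meanGapVar; positivity
  have hc : ((Real.toNNReal (meanGapVar V σ b) : NNReal) : ℝ) = meanGapVar V σ b :=
    Real.coe_toNNReal _ h0.le
  obtain ⟨h1, h2⟩ := integrable_and_integral_exp_sq_gaussianReal_le
    (v := Real.toNNReal (meanGapVar V σ b)) (Real.toNNReal_pos.2 h0) (by rwa [hc])
  rw [hc] at h2
  unfold meanGapVar at h1 h2 ⊢
  rw [← hm] at h1 h2
  refine ⟨h1.comp_measurable (by fun_prop), ?_⟩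
  rwa [integral_map (by fun_prop) (by fun_prop)] at h2

lemma memLp_sampleDensity (hσ : 0 < σ) (hb : b ≠ 0) (h4 : meanGapVar V σ b ≤ 1 / 4) :
    MemLp (sampleDensity σ b) 2 (((gaussianReal 0 V).prod (gaussianReal 0 1)).prod
      (gaussianReal 0 (Real.toNNReal (σ ^ 2)))) := by
  have hms := measurable_sampleDensity σ b
  rw [memLp_two_iff_integrable_sq hms.aestronglyMeasurable,
    integrable_prod_iff (hms.pow_const 2).aestronglyMeasurable]
  refine ⟨Eventually.of_forall fun q => ?_, ?_⟩
  · exact integrable_comp_oneBitSign (fun y => infoDensity ((q.1 + b * q.2) / σ)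
      (q.1 / Real.sqrt (σ ^ 2 + b ^ 2)) y ^ 2) (by fun_prop)
  · refine ((integrable_exp_meanGap hσ hb h4).1.sub (integrable_const 1)).mono'
      ((hms.pow_const 2).norm.stronglyMeasurable.integral_prod_right.aestronglyMeasurable)
      (Eventually.of_forall fun q => ?_)
    simp only [norm_pow, Real.norm_eq_abs, sq_abs]
    rw [abs_of_nonneg (integral_nonneg fun z => sq_nonneg _)]
    exact integral_sampleDensity_sq_noise_le hσ q

lemma integral_sampleDensity_sq_le (hσ : 0 < σ) (hb : b ≠ 0) (h4 : meanGapVar V σ b ≤ 1 / 4) :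
    ∫ ω, sampleDensity σ b ω ^ 2 ∂(((gaussianReal 0 V).prod (gaussianReal 0 1)).prod
      (gaussianReal 0 (Real.toNNReal (σ ^ 2)))) ≤ 2 * meanGapVar V σ b := by
  have hi := (memLp_sampleDensity hσ hb h4).integrable_sq
  obtain ⟨h1, h2⟩ := integrable_exp_meanGap hσ hb h4
  rw [integral_prod _ hi]
  refine (integral_mono hi.integral_prod_left (h1.sub (integrable_const 1))
    fun q => integral_sampleDensity_sq_noise_le hσ q).trans ?_
  simp only [Pi.sub_apply]
  rw [integral_sub h1 (integrable_const 1)]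
  simp only [integral_const, probReal_univ, smul_eq_mul, mul_one]
  linarith

lemma gaussEntropy_eq (x : ℝ) : gaussEntropy x =
    -(gaussQ (-x) * Real.log (gaussQ (-x)) + gaussQ x * Real.log (gaussQ x)) := by
  rw [gaussEntropy, Real.binEntropy, gaussQ_neg, Real.log_inv, Real.log_inv]
  ring

/-- Given the row, the mean density is the cross-entropy of the true sign law relative to the
reference law, minus the entropy of the true one. -/
lemma integral_sampleDensity_noise (hσ : 0 < σ) (q : ℝ × ℝ) :
    ∫ z, sampleDensity σ b (q, z) ∂(gaussianReal 0 (Real.toNNReal (σ ^ 2))) =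
      -(gaussQ (-((q.1 + b * q.2) / σ)) * Real.log (gaussQ (-(q.1 / Real.sqrt (σ ^ 2 + b ^ 2)))) +
        gaussQ ((q.1 + b * q.2) / σ) * Real.log (gaussQ (q.1 / Real.sqrt (σ ^ 2 + b ^ 2)))) -
      gaussEntropy ((q.1 + b * q.2) / σ) := by
  have h := integral_comp_oneBitSign hσ (fun y => infoDensity ((q.1 + b * q.2) / σ)
    (q.1 / Real.sqrt (σ ^ 2 + b ^ 2)) y) (q.1 + b * q.2)
  simp only [sampleDensity]
  rw [h, gaussEntropy_eq]
  simp only [infoDensity, one_mul, neg_mul, neg_neg]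
  ring

lemma integrable_gaussQ_comp {Ω : Type*} [MeasurableSpace Ω] {μ : Measure Ω}
    [IsFiniteMeasure μ] {f : Ω → ℝ} (hf : Measurable f) : Integrable (fun x => gaussQ (f x)) μ := by
  refine (integrable_const (1 : ℝ)).mono'
    (continuous_gaussQ.measurable.comp hf).aestronglyMeasurable (Eventually.of_forall fun x => ?_)
  rw [Real.norm_eq_abs, abs_of_pos (gaussQ_pos _)]
  exact (gaussQ_lt_one _).le

lemma integrable_crossEntropy (σ b c : ℝ) (V : NNReal) :
    Integrable (fun q : ℝ × ℝ => gaussQ ((q.1 + b * q.2) / σ) * Real.log (gaussQ (q.1 / c)))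
      ((gaussianReal 0 V).prod (gaussianReal 0 1)) := by
  have h1 := continuous_gaussQ.measurable
  have hi : Integrable (fun q : ℝ × ℝ => (q.1 / c) ^ 2 + 3)
      ((gaussianReal 0 V).prod (gaussianReal 0 1)) := by
    have h := ((integrable_pow_gaussianReal 2 V).div_const (c ^ 2)).comp_fst (gaussianReal 0 1)
    simp only [← div_pow] at h
    exact h.add (integrable_const 3)
  refine hi.mono' (by fun_prop) (Eventually.of_forall fun q => ?_)
  rw [norm_mul, Real.norm_eq_abs, Real.norm_eq_abs, abs_of_pos (gaussQ_pos _)]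
  have h2 := abs_log_gaussQ_le (q.1 / c)
  have h3 := (gaussQ_lt_one ((q.1 + b * q.2) / σ)).le
  have h4 := abs_nonneg (Real.log (gaussQ (q.1 / c)))
  nlinarith

/-- The logarithms do not involve the hidden entry, so averaging over it only replaces σ by √(σ² +
b²) in the tail probabilities. These then match the logarithms, and the cross-entropy becomes an
entropy. -/
lemma integral_crossEntropy (hσ : 0 < σ) :
    ∫ q : ℝ × ℝ, -(gaussQ (-((q.1 + b * q.2) / σ)) *
        Real.log (gaussQ (-(q.1 / Real.sqrt (σ ^ 2 + b ^ 2)))) +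
        gaussQ ((q.1 + b * q.2) / σ) * Real.log (gaussQ (q.1 / Real.sqrt (σ ^ 2 + b ^ 2))))
        ∂((gaussianReal 0 V).prod (gaussianReal 0 1)) =
      ∫ a, gaussEntropy (a / Real.sqrt (σ ^ 2 + b ^ 2)) ∂(gaussianReal 0 V) := by
  set c := Real.sqrt (σ ^ 2 + b ^ 2)
  have h1 := integrable_crossEntropy σ b c V
  have h2 : Integrable (fun q : ℝ × ℝ => gaussQ (-((q.1 + b * q.2) / σ)) *
      Real.log (gaussQ (-(q.1 / c)))) ((gaussianReal 0 V).prod (gaussianReal 0 1)) := by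
    -- `integrable_crossEntropy` has no sign condition: negating both scales reflects both arguments
    -- of Q.
    simpa only [div_neg] using integrable_crossEntropy (-σ) b (-c) V
  refine (integral_prod _ (h2.add h1).neg).trans ?_
  congr 1
  ext a
  simp only [Pi.neg_apply, Pi.add_apply]
  have hq : Integrable (fun x => gaussQ (-((a + b * x) / σ))) (gaussianReal 0 1) :=
    integrable_gaussQ_comp (by fun_prop)
  have hq' : Integrable (fun x => gaussQ ((a + b * x) / σ)) (gaussianReal 0 1) :=
    integrable_gaussQ_comp (by fun_prop)
  have e1 : ∫ x, gaussQ (-((a + b * x) / σ)) ∂(gaussianReal 0 1) = gaussQ (-(a / c)) :=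
    integral_gaussQ_add_mul hσ a b
  have e2 : ∫ x, gaussQ ((a + b * x) / σ) ∂(gaussianReal 0 1) = gaussQ (a / c) := by
    have h : ∀ x, gaussQ ((a + b * x) / σ) = 1 - gaussQ (-((a + b * x) / σ)) := fun x => by
      rw [gaussQ_neg]; ring
    simp_rw [h]
    rw [integral_sub (integrable_const 1) hq, e1, gaussQ_neg]
    simp
  rw [integral_neg, integral_add (hq.mul_const _) (hq'.mul_const _), integral_mul_const,
    integral_mul_const, e1, e2, gaussEntropy_eq]

/-- The mutual information carried by one measurement is at most a difference of inverse standard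
deviations times `E[W log ((1 - Q(W)) / Q(W))]`. -/
lemma integral_sampleDensity_le (hσ : 0 < σ) (hb : b ≠ 0) (hV : 0 < V)
    (h4 : meanGapVar V σ b ≤ 1 / 4) :
    ∫ ω, sampleDensity σ b ω ∂(((gaussianReal 0 V).prod (gaussianReal 0 1)).prod
      (gaussianReal 0 (Real.toNNReal (σ ^ 2)))) ≤
      ((Real.sqrt (2 * Real.pi * (V / (σ ^ 2 + b ^ 2))))⁻¹ -
        (Real.sqrt (2 * Real.pi * ((V + b ^ 2) / σ ^ 2)))⁻¹) * meanWLogOdds := by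
  have hi := (memLp_sampleDensity hσ hb h4).integrable (by norm_num)
  have hV' : (0 : ℝ) < V := hV
  have hc : 0 < σ ^ 2 + b ^ 2 := by positivity
  rw [integral_prod _ hi]
  simp_rw [integral_sampleDensity_noise hσ]
  rw [integral_sub ?_ (integrable_gaussEntropy_comp (by fun_prop)), integral_crossEntropy hσ]
  -- Both entropies become integrals over one centred Gaussian, of variance (V + b²)/σ² for the true
  -- mean and V/(σ² + b²) for the reference mean.
  · have hs := gaussianReal_prod_map_linear V 1 σ⁻¹ (b / σ)
    have e1 : ∫ q : ℝ × ℝ, gaussEntropy ((q.1 + b * q.2) / σ)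
        ∂((gaussianReal 0 V).prod (gaussianReal 0 1)) =
        ∫ x, gaussEntropy x ∂(gaussianReal 0 (Real.toNNReal ((V + b ^ 2) / σ ^ 2))) := by
      rw [show (V + b ^ 2) / σ ^ 2 = σ⁻¹ ^ 2 * V + (b / σ) ^ 2 * (1 : NNReal) by
        push_cast; field_simp, ← hs, integral_map (by fun_prop)
        continuous_gaussEntropy.aestronglyMeasurable]
      congr 1
      ext q
      congr 1
      field_simp
    have e2 : ∫ a, gaussEntropy (a / Real.sqrt (σ ^ 2 + b ^ 2)) ∂(gaussianReal 0 V) =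
        ∫ x, gaussEntropy x ∂(gaussianReal 0 (Real.toNNReal (V / (σ ^ 2 + b ^ 2)))) := by
      have h := gaussianReal_map_div_const (μ := 0) (v := V) (Real.sqrt (σ ^ 2 + b ^ 2))
      rw [show Real.toNNReal (V / (σ ^ 2 + b ^ 2)) =
        V / .mk (Real.sqrt (σ ^ 2 + b ^ 2) ^ 2) (sq_nonneg _) from ?_]
      · rw [zero_div] at h
        rw [← h, integral_map (by fun_prop) continuous_gaussEntropy.aestronglyMeasurable]
      · rw [← NNReal.coe_inj, Real.coe_toNNReal _ (by positivity), NNReal.coe_div]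
        simp [Real.sq_sqrt hc.le]
    have h := integral_gaussEntropy_sub_le (v := Real.toNNReal (V / (σ ^ 2 + b ^ 2)))
      (w := Real.toNNReal ((V + b ^ 2) / σ ^ 2)) (Real.toNNReal_pos.2 (by positivity))
      (Real.toNNReal_le_toNNReal (by
        gcongr
        · exact le_add_of_nonneg_right (sq_nonneg b)
        · exact le_add_of_nonneg_right (sq_nonneg b)))
    rw [Real.coe_toNNReal _ (by positivity), Real.coe_toNNReal _ (by positivity)] at h
    rw [e1, e2]
    exact h
  · refine Integrable.neg (Integrable.add ?_ (integrable_crossEntropy σ b _ V))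
    simpa only [div_neg] using integrable_crossEntropy (-σ) b (-Real.sqrt (σ ^ 2 + b ^ 2)) V

end

/-! ### Law of a row and concentration over independent rows -/

lemma iIndepFun_eval_gaussianReal (p : ℕ) :
    iIndepFun (fun (i : Fin p) (x : Fin p → ℝ) => x i)
      (Measure.pi fun _ : Fin p => gaussianReal 0 1) :=
  iIndepFun_pi (X := fun _ x => x) fun _ => aemeasurable_id

lemma pi_gaussianReal_map_eval {p : ℕ} (i : Fin p) :
    (Measure.pi fun _ : Fin p => gaussianReal 0 1).map (fun x => x i) = gaussianReal 0 1 :=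
  (measurePreserving_eval (fun _ : Fin p => gaussianReal 0 1) i).map_eq

lemma pi_gaussianReal_map_sum {p : ℕ} (T : Finset (Fin p)) :
    (Measure.pi fun _ : Fin p => gaussianReal 0 1).map (∑ i ∈ T, fun x => x i) =
      gaussianReal 0 (T.card : NNReal) := by
  classical
  induction T using Finset.induction_on with
  | empty =>
    simp only [Finset.sum_empty, Finset.card_empty, Nat.cast_zero, gaussianReal_zero_var]
    change Measure.map (fun _ => (0 : ℝ)) _ = _
    rw [Measure.map_const, measure_univ, one_smul]
  | insert j T hj ih =>
    have hind := (iIndepFun_eval_gaussianReal p).indepFun_finsetSum_of_notMem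
      (fun i => measurable_pi_apply i) hj
    have h := gaussianReal_add_gaussianReal_of_indepFun hind ih (pi_gaussianReal_map_eval j)
    rw [Finset.sum_insert hj, add_comm, h, Finset.card_insert_of_notMem hj]
    simp

lemma sum_mul_sparseVector {p : ℕ} (b : ℝ) (T : Finset (Fin p)) (x : Fin p → ℝ) :
    ∑ i, x i * sparseVector b T i = b * ∑ i ∈ T, x i := by
  simp only [sparseVector, mul_ite, mul_zero, Finset.sum_ite_mem, Finset.univ_inter]
  rw [Finset.mul_sum]
  exact Finset.sum_congr rfl fun i _ => mul_comm _ _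

lemma sum_mul_sparseVector_insert {p : ℕ} (b : ℝ) {T : Finset (Fin p)} {j : Fin p} (hj : j ∉ T)
    (x : Fin p → ℝ) : ∑ i, x i * sparseVector b (insert j T) i =
      ∑ i, x i * sparseVector b T i + b * x j := by
  rw [sum_mul_sparseVector, sum_mul_sparseVector, Finset.sum_insert hj]
  ring

/-- The contribution of the columns in `T` and a further entry of the row are independent. -/
lemma measurePreserving_sum_mul_sparseVector {p : ℕ} (b : ℝ) {T : Finset (Fin p)} {j : Fin p}
    (hj : j ∉ T) : MeasurePreserving (fun x : Fin p → ℝ => (∑ i, x i * sparseVector b T i, x j))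
      (Measure.pi fun _ : Fin p => gaussianReal 0 1)
      ((gaussianReal 0 (Real.toNNReal (T.card * b ^ 2))).prod (gaussianReal 0 1)) := by
  refine ⟨by fun_prop, ?_⟩
  have hind := ((iIndepFun_eval_gaussianReal p).indepFun_finsetSum_of_notMem
    (fun i => measurable_pi_apply i) hj).comp (φ := fun t => b * t) (ψ := id)
    (by fun_prop) measurable_id
  have hm : Measurable (∑ i ∈ T, fun x : Fin p → ℝ => x i) := by
    rw [Finset.sum_fn]
    exact Finset.measurable_sum T fun i _ => measurable_pi_apply i
  have h := (indepFun_iff_map_prod_eq_prod_map_map (by fun_prop)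
    (measurable_id.comp (measurable_pi_apply j)).aemeasurable).1 hind
  have e : (fun x : Fin p → ℝ => (∑ i, x i * sparseVector b T i, x j)) = fun ω =>
      (((fun t => b * t) ∘ ∑ i ∈ T, fun x : Fin p → ℝ => x i) ω, (id ∘ fun x : Fin p → ℝ => x j) ω) := by
    ext x
    · simp [sum_mul_sparseVector]
    · rfl
  rw [e, h, ← Measure.map_map (by fun_prop) hm, pi_gaussianReal_map_sum, Function.id_comp,
    pi_gaussianReal_map_eval, gaussianReal_map_const_mul, mul_zero]
  congr 2
  rw [← NNReal.coe_inj, Real.coe_toNNReal _ (by positivity)]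
  simp [mul_comm]

/-- Chebyshev's inequality for a sum over independent pairs. -/
lemma measure_lt_sum_le {n : ℕ} {α β : Type*} [MeasurableSpace α] [MeasurableSpace β]
    {μ : Measure α} {ν : Measure β} [IsProbabilityMeasure μ] [IsProbabilityMeasure ν]
    {f : α × β → ℝ} (hfm : Measurable f) (hf : MemLp f 2 (μ.prod ν)) {m₁ m₂ γ : ℝ}
    (h1 : ∫ ω, f ω ∂(μ.prod ν) ≤ m₁) (h2 : ∫ ω, f ω ^ 2 ∂(μ.prod ν) ≤ m₂) (hγ : n * m₁ < γ) :
    ((Measure.pi fun _ : Fin n => μ).prod (Measure.pi fun _ : Fin n => ν))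
      {ω | γ < ∑ i, f (ω.1 i, ω.2 i)} ≤ ENNReal.ofReal (n * m₂ / (γ - n * m₁) ^ 2) := by
  -- Regrouping the two arrays as one array of i.i.d. pairs turns the sum into a sum of independent
  -- terms.
  have hmp := measurePreserving_arrowProdEquivProdArrow α β (Fin n) (fun _ => μ) (fun _ => ν)
  have hS : MeasurableSet {ω : (Fin n → α) × (Fin n → β) | γ < ∑ i, f (ω.1 i, ω.2 i)} :=
    measurableSet_lt measurable_const (by fun_prop)
  rw [← hmp.measure_preimage hS.nullMeasurableSet]
  set P := Measure.pi fun _ : Fin n => μ.prod ν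
  set X : (Fin n → α × β) → ℝ := ∑ i : Fin n, fun ω => f (ω i)
  have hXi : ∀ i : Fin n, MemLp (fun ω : Fin n → α × β => f (ω i)) 2 P := fun i =>
    hf.comp_measurePreserving (measurePreserving_eval (fun _ : Fin n => μ.prod ν) i)
  have hX : MemLp X 2 P := memLp_finsetSum' _ fun i _ => hXi i
  have hmean : ∫ ω, X ω ∂P ≤ n * m₁ := by
    simp only [X, Finset.sum_apply]
    rw [integral_finsetSum _ fun i _ => (hXi i).integrable (by norm_num)]
    have : ∀ i : Fin n, ∫ ω, f (ω i) ∂P = ∫ ω, f ω ∂(μ.prod ν) := fun i =>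
      integral_comp_eval (μ := fun _ : Fin n => μ.prod ν) hfm.aestronglyMeasurable
    simp only [this, Finset.sum_const, Finset.card_univ, Fintype.card_fin, nsmul_eq_mul]
    gcongr
  have hvar : Var[X; P] ≤ n * m₂ := by
    have h := variance_sum_pi (μ := fun _ : Fin n => μ.prod ν) (X := fun _ => f) fun _ => hf
    rw [h]
    simp only [Finset.sum_const, Finset.card_univ, Fintype.card_fin, nsmul_eq_mul]
    gcongr
    exact (variance_le_expectation_sq hf.aestronglyMeasurable).trans h2
  have hc : 0 < γ - n * m₁ := by linarith
  refine (measure_mono fun ω hω => ?_).trans ((meas_ge_le_variance_div_sq hX hc).trans ?_)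
  · have hω' : γ < X ω := by
      simp only [X, Finset.sum_apply]
      exact hω
    simp only [Set.mem_ofPred_eq]
    exact le_trans (by linarith) (le_abs_self _)
  · gcongr

/-! ### Change of measure for sign vectors -/

lemma oneBitSign_mem (t : ℝ) : oneBitSign t ∈ ({1, -1} : Finset ℝ) := by
  unfold oneBitSign
  split_ifs <;> simp

lemma gaussianReal_oneBitSign_eq {σ : ℝ} (hσ : 0 < σ) (a : ℝ) {y : ℝ}
    (hy : y ∈ ({1, -1} : Finset ℝ)) :
    gaussianReal 0 (Real.toNNReal (σ ^ 2)) {z | oneBitSign (a + z) = y} =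
      ENNReal.ofReal (gaussQ (-(y * (a / σ)))) := by
  have hS : MeasurableSet {z : ℝ | 0 ≤ a + z} := measurableSet_le measurable_const (by fun_prop)
  simp only [Finset.mem_insert, Finset.mem_singleton] at hy
  rw [← ofReal_measureReal]
  congr 1
  rcases hy with rfl | rfl
  · rw [one_mul, ← gaussianReal_nonneg_add hσ]
    congr 1
    ext z
    simp only [Set.mem_ofPred_eq, oneBitSign]
    split_ifs with h <;> simp [h]
    norm_num
  · rw [neg_one_mul, neg_neg, ← sub_sub_cancel 1 (gaussQ (a / σ)), ← gaussQ_neg,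
      ← gaussianReal_nonneg_add hσ, ← probReal_compl_eq_one_sub hS]
    congr 1
    ext z
    simp only [Set.mem_ofPred_eq, oneBitSign, Set.mem_compl_iff]
    split_ifs with h <;> simp [h]
    norm_num

lemma pi_gaussianReal_oneBitSign_eq {n : ℕ} {σ : ℝ} (hσ : 0 < σ) (a : Fin n → ℝ) {y : Fin n → ℝ}
    (hy : y ∈ Fintype.piFinset fun _ : Fin n => ({1, -1} : Finset ℝ)) :
    (Measure.pi fun _ : Fin n => gaussianReal 0 (Real.toNNReal (σ ^ 2)))
      {z | (fun i => oneBitSign (a i + z i)) = y} =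
      ENNReal.ofReal (∏ i, gaussQ (-(y i * (a i / σ)))) := by
  have : {z : Fin n → ℝ | (fun i => oneBitSign (a i + z i)) = y} =
      Set.univ.pi fun i => {z | oneBitSign (a i + z) = y i} := by
    ext z
    simp [funext_iff]
  rw [this, Measure.pi_pi, ENNReal.ofReal_prod_of_nonneg fun i _ => gaussQ_nonneg _]
  exact Finset.prod_congr rfl fun i _ =>
    gaussianReal_oneBitSign_eq hσ (a i) (Fintype.mem_piFinset.1 hy i)

/-- Change of measure for a vector of signs, on the event that the information density is
at most `γ`. -/
lemma pi_gaussianReal_changeOfMeasure {n : ℕ} {σ τ : ℝ} (hσ : 0 < σ) (hτ : 0 < τ)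
    (a a' : Fin n → ℝ) (B : Set (Fin n → ℝ)) (γ : ℝ) :
    (Measure.pi fun _ : Fin n => gaussianReal 0 (Real.toNNReal (σ ^ 2)))
      {z | (fun i => oneBitSign (a i + z i)) ∈ B ∧
        ∑ i, infoDensity (a i / σ) (a' i / τ) (oneBitSign (a i + z i)) ≤ γ} ≤
    ENNReal.ofReal (Real.exp γ) *
      (Measure.pi fun _ : Fin n => gaussianReal 0 (Real.toNNReal (τ ^ 2)))
        {z | (fun i => oneBitSign (a' i + z i)) ∈ B} := by
  classical
  -- Sign vectors form a finite cube, so the two laws are compared atom by atom and `B` need not be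
  -- measurable.
  set Y := (Fintype.piFinset fun _ : Fin n => ({1, -1} : Finset ℝ)).filter fun y =>
    y ∈ B ∧ ∑ i, infoDensity (a i / σ) (a' i / τ) (y i) ≤ γ
  have hmeas : ∀ y ∈ Y, MeasurableSet {z : Fin n → ℝ | (fun i => oneBitSign (a' i + z i)) = y} := by
    intro y _
    have : Measurable fun z : Fin n → ℝ => fun i => oneBitSign (a' i + z i) :=
      measurable_pi_lambda _ fun i => measurable_oneBitSign.comp (by fun_prop)
    exact this (measurableSet_singleton y)
  calc _ ≤ (Measure.pi fun _ : Fin n => gaussianReal 0 (Real.toNNReal (σ ^ 2)))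
          (⋃ y ∈ Y, {z | (fun i => oneBitSign (a i + z i)) = y}) := by
        refine measure_mono fun z hz => ?_
        simp only [Set.mem_iUnion]
        refine ⟨fun i => oneBitSign (a i + z i), ?_, rfl⟩
        exact Finset.mem_filter.2 ⟨Fintype.mem_piFinset.2 fun i => oneBitSign_mem _, hz.1, hz.2⟩
    _ ≤ ∑ y ∈ Y, (Measure.pi fun _ : Fin n => gaussianReal 0 (Real.toNNReal (σ ^ 2)))
          {z | (fun i => oneBitSign (a i + z i)) = y} := measure_biUnion_finset_le _ _
    _ ≤ ∑ y ∈ Y, ENNReal.ofReal (Real.exp γ) *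
          (Measure.pi fun _ : Fin n => gaussianReal 0 (Real.toNNReal (τ ^ 2)))
            {z | (fun i => oneBitSign (a' i + z i)) = y} := by
        refine Finset.sum_le_sum fun y hy => ?_
        obtain ⟨hy1, hy2, hy3⟩ := Finset.mem_filter.1 hy
        rw [pi_gaussianReal_oneBitSign_eq hσ a hy1, pi_gaussianReal_oneBitSign_eq hτ a' hy1,
          ← ENNReal.ofReal_mul (Real.exp_pos _).le]
        refine ENNReal.ofReal_le_ofReal ?_
        have h : ∀ s : Fin n → ℝ, ∏ i, gaussQ (-(y i * s i)) =
            Real.exp (∑ i, Real.log (gaussQ (-(y i * s i)))) := fun s => by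
          rw [Real.exp_sum]
          exact Finset.prod_congr rfl fun i _ => (Real.exp_log (gaussQ_pos _)).symm
        rw [h fun i => a i / σ, h fun i => a' i / τ, ← Real.exp_add, Real.exp_le_exp]
        simp only [infoDensity, Finset.sum_sub_distrib] at hy3
        linarith
    _ = ENNReal.ofReal (Real.exp γ) *
          (Measure.pi fun _ : Fin n => gaussianReal 0 (Real.toNNReal (τ ^ 2)))
            (⋃ y ∈ Y, {z | (fun i => oneBitSign (a' i + z i)) = y}) := by
        rw [← Finset.mul_sum, measure_biUnion_finset ?_ hmeas]
        intro y _ y' _ hne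
        exact Set.disjoint_left.2 fun z hz hz' => hne (hz.symm.trans hz')
    _ ≤ _ := by
        gcongr
        intro z hz
        simp only [Set.mem_iUnion] at hz
        obtain ⟨y, hy, hz⟩ := hz
        have hz' : (fun i => oneBitSign (a' i + z i)) = y := hz
        change (fun i => oneBitSign (a' i + z i)) ∈ B
        rw [hz']
        exact (Finset.mem_filter.1 hy).2.1

/-! ### The converse with one hidden support element -/

/-- The joint law of the measurement matrix and the noise. -/
noncomputable def designNoiseLaw (p n : ℕ) (σ : ℝ) : Measure ((Fin n → Fin p → ℝ) × (Fin n → ℝ)) :=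
  (Measure.pi fun _ : Fin n => Measure.pi fun _ : Fin p => gaussianReal 0 1).prod
    (Measure.pi fun _ : Fin n => gaussianReal 0 (Real.toNNReal (σ ^ 2)))

instance (p n : ℕ) (σ : ℝ) : IsProbabilityMeasure (designNoiseLaw p n σ) := by
  unfold designNoiseLaw
  infer_instance

/-- The event that the decoder outputs `S` when the true support is `T`. -/
def decodeEvent {p n : ℕ} (b : ℝ) (dec : SupportDecoder p n) (T S : Finset (Fin p)) :
    Set ((Fin n → Fin p → ℝ) × (Fin n → ℝ)) :=
  {ω | dec (ω.1, oneBitObservation (sparseVector b T) ω.1 ω.2) = S}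

section
variable {p n : ℕ} {dec : SupportDecoder p n}

lemma measurableSet_decodeEvent (hdec : Measurable dec) (b : ℝ) (T S : Finset (Fin p)) :
    MeasurableSet (decodeEvent b dec T S) := by
  have hobs : Measurable fun ω : (Fin n → Fin p → ℝ) × (Fin n → ℝ) =>
      oneBitObservation (sparseVector b T) ω.1 ω.2 :=
    measurable_pi_lambda _ fun i => measurable_oneBitSign.comp (by fun_prop)
  exact (hdec.comp (measurable_fst.prodMk hobs)) (measurableSet_singleton S)

lemma designNoiseLaw_lt_sum_sampleDensity_le (n : ℕ) {σ b : ℝ} (hσ : 0 < σ) (hb : b ≠ 0)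
    {T : Finset (Fin p)} {j : Fin p} (hj : j ∉ T)
    (h4 : meanGapVar (T.card * b ^ 2) σ b ≤ 1 / 4) {m₁ γ : ℝ}
    (h1 : ∫ ω, sampleDensity σ b ω
      ∂(((gaussianReal 0 (Real.toNNReal (T.card * b ^ 2))).prod (gaussianReal 0 1)).prod
        (gaussianReal 0 (Real.toNNReal (σ ^ 2)))) ≤ m₁) (hγ : n * m₁ < γ) :
    designNoiseLaw p n σ {ω | γ <
      ∑ i, sampleDensity σ b ((∑ l, ω.1 i l * sparseVector b T l, ω.1 i j), ω.2 i)} ≤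
    ENNReal.ofReal (n * (2 * meanGapVar (T.card * b ^ 2) σ b) / (γ - n * m₁) ^ 2) := by
  have hV : ((Real.toNNReal (T.card * b ^ 2) : NNReal) : ℝ) = T.card * b ^ 2 :=
    Real.coe_toNNReal _ (by positivity)
  have h4' : meanGapVar (Real.toNNReal (T.card * b ^ 2)) σ b ≤ 1 / 4 := by rwa [hV]
  have hmp := (measurePreserving_sum_mul_sparseVector b hj).prod
    (MeasurePreserving.id (gaussianReal 0 (Real.toNNReal (σ ^ 2))))
  have hms := measurable_sampleDensity σ b
  have hsq := integral_sampleDensity_sq_le hσ hb h4'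
  rw [hV] at hsq
  rw [← hmp.map_eq, integral_map hmp.measurable.aemeasurable
    (hms.pow_const 2).aestronglyMeasurable] at hsq
  rw [← hmp.map_eq, integral_map hmp.measurable.aemeasurable hms.aestronglyMeasurable] at h1
  exact measure_lt_sum_le (n := n) (hms.comp hmp.measurable)
    ((memLp_sampleDensity hσ hb h4').comp_measurePreserving hmp) h1 hsq hγ

/-- The change of measure is applied for each fixed matrix. The decoder sees column j under both
laws, but under the reference law the observations do not depend on it. -/
lemma designNoiseLaw_decodeEvent_inter_le (hdec : Measurable dec) {σ b : ℝ} (hσ : 0 < σ)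
    {T : Finset (Fin p)} {j : Fin p} (hj : j ∉ T) (γ : ℝ) :
    designNoiseLaw p n σ (decodeEvent b dec (insert j T) (insert j T) ∩ {ω |
      ∑ i, sampleDensity σ b ((∑ l, ω.1 i l * sparseVector b T l, ω.1 i j), ω.2 i) ≤ γ}) ≤
    ENNReal.ofReal (Real.exp γ) * designNoiseLaw p n (Real.sqrt (σ ^ 2 + b ^ 2))
      (decodeEvent b dec T (insert j T)) := by
  have hτ : 0 < Real.sqrt (σ ^ 2 + b ^ 2) := Real.sqrt_pos.2 (by positivity)
  have hE := measurableSet_decodeEvent hdec b (insert j T) (insert j T)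
  have hE' := measurableSet_decodeEvent hdec b T (insert j T)
  have hG : MeasurableSet {ω : (Fin n → Fin p → ℝ) × (Fin n → ℝ) |
      ∑ i, sampleDensity σ b ((∑ l, ω.1 i l * sparseVector b T l, ω.1 i j), ω.2 i) ≤ γ} := by
    have hms := measurable_sampleDensity σ b
    refine measurableSet_le (Finset.measurable_sum _ fun i _ => hms.comp ?_) measurable_const
    fun_prop
  unfold designNoiseLaw
  rw [Measure.prod_apply (hE.inter hG), Measure.prod_apply hE',
    ← lintegral_const_mul _ (measurable_measure_prodMk_left hE')]
  refine lintegral_mono fun x => ?_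
  have h := pi_gaussianReal_changeOfMeasure hσ hτ
    (fun i => ∑ l, x i l * sparseVector b (insert j T) l)
    (fun i => ∑ l, x i l * sparseVector b T l) {y | dec (x, y) = insert j T} γ
  refine le_trans (measure_mono ?_) h
  rintro z ⟨hz1, hz2⟩
  refine ⟨hz1, ?_⟩
  simp only [sum_mul_sparseVector_insert b hj]
  exact hz2

/-- The success probability on the support `insert j T` is controlled by the probability of the
same decision when the signal is supported on `T` and the noise variance is `σ² + b²`. -/
lemma designNoiseLaw_decodeEvent_le (hdec : Measurable dec) {σ b : ℝ} (hσ : 0 < σ) (hb : b ≠ 0)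
    {T : Finset (Fin p)} {j : Fin p} (hj : j ∉ T)
    (h4 : meanGapVar (T.card * b ^ 2) σ b ≤ 1 / 4) {m₁ γ : ℝ}
    (h1 : ∫ ω, sampleDensity σ b ω
      ∂(((gaussianReal 0 (Real.toNNReal (T.card * b ^ 2))).prod (gaussianReal 0 1)).prod
        (gaussianReal 0 (Real.toNNReal (σ ^ 2)))) ≤ m₁) (hγ : n * m₁ < γ) :
    (designNoiseLaw p n σ).real (decodeEvent b dec (insert j T) (insert j T)) ≤
      n * (2 * meanGapVar (T.card * b ^ 2) σ b) / (γ - n * m₁) ^ 2 + Real.exp γ *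
        (designNoiseLaw p n (Real.sqrt (σ ^ 2 + b ^ 2))).real
          (decodeEvent b dec T (insert j T)) := by
  have h0 : 0 ≤ n * (2 * meanGapVar (T.card * b ^ 2) σ b) / (γ - n * m₁) ^ 2 := by
    unfold meanGapVar
    positivity
  refine ENNReal.toReal_le_of_le_ofReal (by positivity) ?_
  rw [ENNReal.ofReal_add h0 (by positivity), ENNReal.ofReal_mul (Real.exp_pos γ).le,
    ofReal_measureReal]
  refine le_trans (measure_mono fun ω hω => ?_) ((measure_union_le _ _).trans
    (add_le_add (designNoiseLaw_lt_sum_sampleDensity_le n hσ hb hj h4 h1 hγ)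
      (designNoiseLaw_decodeEvent_inter_le hdec hσ hj γ)))
  rcases lt_or_ge γ (∑ i, sampleDensity σ b
    ((∑ l, ω.1 i l * sparseVector b T l, ω.1 i j), ω.2 i)) with h | h
  · exact Or.inl h
  · exact Or.inr ⟨hω, h⟩

/-- The law and the signal are the same for every j, and distinct j outside T correspond to distinct
decoder outputs, so the events are disjoint. -/
lemma sum_decodeEvent_insert_le_one (hdec : Measurable dec) (σ b : ℝ) (T : Finset (Fin p)) :
    ∑ j ∈ Tᶜ, (designNoiseLaw p n σ).real (decodeEvent b dec T (insert j T)) ≤ 1 := by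
  rw [← measureReal_biUnion_finset ?_ fun j _ => measurableSet_decodeEvent hdec b T (insert j T)]
  · exact measureReal_le_one
  · intro j hj j' _ hne
    refine Set.disjoint_left.2 fun ω hω hω' => hne ?_
    have h : insert j T = insert j' T := hω.symm.trans hω'
    have h2 : j ∈ insert j' T := h ▸ Finset.mem_insert_self j T
    exact (Finset.mem_insert.1 h2).resolve_right (Finset.mem_compl.1 hj)

/-- A k-set with a marked element is the same as a (k - 1)-set with a marked element of its
complement. -/
lemma sum_powersetCard_erase {k : ℕ} (hk : 1 ≤ k) (F : Finset (Fin p) → Fin p → ℝ) :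
    ∑ S ∈ Finset.powersetCard k Finset.univ, ∑ j ∈ S, F (S.erase j) j =
      ∑ T ∈ Finset.powersetCard (k - 1) Finset.univ, ∑ j ∈ Tᶜ, F T j := by
  rw [Finset.sum_sigma', Finset.sum_sigma']
  refine Finset.sum_bij' (fun q _ => ⟨q.1.erase q.2, q.2⟩) (fun q _ => ⟨insert q.2 q.1, q.2⟩)
    ?_ ?_ ?_ ?_ ?_
  · rintro ⟨S, j⟩ h
    simp only [Finset.mem_sigma, Finset.mem_powersetCard_univ] at h
    simp [Finset.card_erase_of_mem h.2, h.1]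
  · rintro ⟨T, j⟩ h
    simp only [Finset.mem_sigma, Finset.mem_powersetCard_univ, Finset.mem_compl] at h
    simp [Finset.card_insert_of_notMem h.2, h.1]
    omega
  · rintro ⟨S, j⟩ h
    simp only [Finset.mem_sigma] at h
    simp [Finset.insert_erase h.2]
  · rintro ⟨T, j⟩ h
    simp only [Finset.mem_sigma, Finset.mem_compl] at h
    simp [Finset.erase_insert h.2]
  · rintro ⟨S, j⟩ _
    rfl

lemma isProbabilityMeasure_uniformOn_card {k : ℕ} (hk : k ≤ p) :
    IsProbabilityMeasure (uniformOn {s : Finset (Fin p) | s.card = k}) := by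
  refine isProbabilityMeasure_uniformOn (Set.toFinite _) ?_
  obtain ⟨s, -, hs⟩ := Finset.exists_subset_card_eq (s := (Finset.univ : Finset (Fin p))) (n := k)
    (by simpa using hk)
  exact ⟨s, hs⟩

lemma uniformOn_card_real_singleton (k : ℕ) (S : Finset (Fin p)) :
    (uniformOn {s : Finset (Fin p) | s.card = k}).real {S} =
      if S ∈ Finset.powersetCard k Finset.univ then ((p.choose k : ℕ) : ℝ)⁻¹ else 0 := by
  have hs : {s : Finset (Fin p) | s.card = k} =
      ((Finset.powersetCard k Finset.univ : Finset (Finset (Fin p))) : Set (Finset (Fin p))) := by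
    ext s
    simp
  rw [hs, ← Finset.coe_singleton, Measure.real, uniformOn_apply_finset, Finset.card_powersetCard,
    Finset.card_univ, Fintype.card_fin]
  split_ifs with h
  · rw [Finset.inter_singleton_of_mem h]
    simp
  · rw [Finset.inter_singleton_of_notMem h]
    simp

lemma oneBitErrorProb_eq (hdec : Measurable dec) {k : ℕ} (hk : k ≤ p) (σ b : ℝ) :
    oneBitErrorProb k σ b dec = 1 - (∑ S ∈ Finset.powersetCard k Finset.univ,
      (designNoiseLaw p n σ).real (decodeEvent b dec S S)) / (p.choose k : ℕ) := by
  have := isProbabilityMeasure_uniformOn_card hk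
  set A : Set (Finset (Fin p) × (Fin n → Fin p → ℝ) × (Fin n → ℝ)) :=
    {ω | dec (ω.2.1, oneBitObservation (sparseVector b ω.1) ω.2.1 ω.2.2) = ω.1}
  have hA : MeasurableSet A := by
    have : A = ⋃ S : Finset (Fin p), {S} ×ˢ decodeEvent b dec S S := by
      ext ⟨S, ω⟩
      simp [A, decodeEvent]
    rw [this]
    exact MeasurableSet.iUnion fun S =>
      (measurableSet_singleton S).prod (measurableSet_decodeEvent hdec b S S)
  have hlaw : oneBitLaw p k n σ = (uniformOn {s : Finset (Fin p) | s.card = k}).prod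
    (designNoiseLaw p n σ) := rfl
  have hprob : IsProbabilityMeasure (oneBitLaw p k n σ) := by
    rw [hlaw]
    infer_instance
  have h1 : oneBitErrorProb k σ b dec = 1 - (oneBitLaw p k n σ).real A := by
    rw [← probReal_compl_eq_one_sub hA]
    rfl
  rw [h1, hlaw, Measure.real, Measure.prod_apply hA, lintegral_fintype, ENNReal.toReal_sum fun S _ =>
    ENNReal.mul_ne_top (measure_ne_top _ _) (measure_ne_top _ _)]
  simp only [ENNReal.toReal_mul, ← measureReal_def, uniformOn_card_real_singleton, mul_ite, mul_zero]
  rw [Finset.sum_ite_mem, Finset.univ_inter, ← Finset.sum_mul, div_eq_mul_inv]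
  rfl

/-- A non-asymptotic converse: revealing all but one element of the support reduces decoding to a
test between `p - k + 1` hypotheses. -/
lemma one_sub_oneBitErrorProb_le (hdec : Measurable dec) {k : ℕ} (hk1 : 1 ≤ k) (hk : k ≤ p)
    {σ b : ℝ} (hσ : 0 < σ) (hb : b ≠ 0)
    (h4 : meanGapVar ((k - 1 : ℕ) * b ^ 2) σ b ≤ 1 / 4) {m₁ γ : ℝ}
    (h1 : ∫ ω, sampleDensity σ b ω
      ∂(((gaussianReal 0 (Real.toNNReal ((k - 1 : ℕ) * b ^ 2))).prod (gaussianReal 0 1)).prod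
        (gaussianReal 0 (Real.toNNReal (σ ^ 2)))) ≤ m₁) (hγ : n * m₁ < γ) :
    1 - oneBitErrorProb k σ b dec ≤
      n * (2 * meanGapVar ((k - 1 : ℕ) * b ^ 2) σ b) / (γ - n * m₁) ^ 2 +
        Real.exp γ / ((p : ℝ) - k + 1) := by
  set δ := n * (2 * meanGapVar ((k - 1 : ℕ) * b ^ 2) σ b) / (γ - n * m₁) ^ 2
  set τ := Real.sqrt (σ ^ 2 + b ^ 2)
  rw [oneBitErrorProb_eq hdec hk, sub_sub_cancel]
  have hC : (0 : ℝ) < (p.choose k : ℕ) := by exact_mod_cast Nat.choose_pos hk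
  have hk0 : (0 : ℝ) < k := by exact_mod_cast hk1
  have hM : (0 : ℝ) < (p : ℝ) - k + 1 := by
    have : (k : ℝ) ≤ p := by exact_mod_cast hk
    linarith
  -- The marked pairs counted in both ways; this is the source of the factor p - k + 1.
  have hchoose : ((p.choose k : ℕ) : ℝ) * k = (p.choose (k - 1) : ℕ) * ((p : ℝ) - k + 1) := by
    have h := Nat.choose_succ_right_eq p (k - 1)
    rw [Nat.sub_add_cancel hk1] at h
    have h2 : ((p - (k - 1) : ℕ) : ℝ) = (p : ℝ) - k + 1 := by
      rw [Nat.cast_sub (by omega), Nat.cast_sub hk1]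
      push_cast
      ring
    rw [← h2]
    exact_mod_cast h
  -- Any j in S may play the hidden element, so the bound is summed over all k choices.
  have hS : ∀ S ∈ Finset.powersetCard k (Finset.univ : Finset (Fin p)),
      k * (designNoiseLaw p n σ).real (decodeEvent b dec S S) ≤ k * δ + Real.exp γ *
        ∑ j ∈ S, (designNoiseLaw p n τ).real
          (decodeEvent b dec (S.erase j) (insert j (S.erase j))) := by
    intro S hS
    have hcard : S.card = k := (Finset.mem_powersetCard_univ).1 hS
    have : ∀ j ∈ S, (designNoiseLaw p n σ).real (decodeEvent b dec S S) ≤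
        δ + Real.exp γ * (designNoiseLaw p n τ).real
          (decodeEvent b dec (S.erase j) (insert j (S.erase j))) := by
      intro j hj
      have hc : (S.erase j).card = k - 1 := by rw [Finset.card_erase_of_mem hj, hcard]
      have h := designNoiseLaw_decodeEvent_le (n := n) hdec hσ hb (Finset.notMem_erase j S)
        (by rw [hc]; exact h4) (m₁ := m₁) (γ := γ) (by rw [hc]; exact h1) hγ
      rw [hc] at h
      rwa [Finset.insert_erase hj] at h ⊢
    have h := Finset.sum_le_sum this
    rw [Finset.sum_const, Finset.sum_add_distrib, Finset.sum_const, ← Finset.mul_sum, hcard,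
      nsmul_eq_mul, nsmul_eq_mul] at h
    exact h
  have hsum := Finset.sum_le_sum hS
  rw [← Finset.mul_sum, Finset.sum_add_distrib, Finset.sum_const, Finset.card_powersetCard,
    Finset.card_univ, Fintype.card_fin, ← Finset.mul_sum,
    sum_powersetCard_erase hk1 fun T j => (designNoiseLaw p n τ).real
      (decodeEvent b dec T (insert j T)), nsmul_eq_mul] at hsum
  have hT : ∑ T ∈ Finset.powersetCard (k - 1) (Finset.univ : Finset (Fin p)), ∑ j ∈ Tᶜ,
      (designNoiseLaw p n τ).real (decodeEvent b dec T (insert j T)) ≤ (p.choose (k - 1) : ℕ) := by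
    refine (Finset.sum_le_sum fun T _ => sum_decodeEvent_insert_le_one hdec τ b T).trans ?_
    simp
  rw [div_le_iff₀ hC]
  refine le_of_mul_le_mul_left ?_ hk0
  have e : (k : ℝ) * ((δ + Real.exp γ / ((p : ℝ) - k + 1)) * (p.choose k : ℕ)) =
      (p.choose k : ℕ) * (k * δ) + Real.exp γ * (p.choose (k - 1) : ℕ) := by
    have : Real.exp γ / ((p : ℝ) - k + 1) * (((p.choose k : ℕ) : ℝ) * k) =
        Real.exp γ * (p.choose (k - 1) : ℕ) := by
      rw [hchoose]
      field_simp
    rw [← this]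
    ring
  rw [e]
  exact hsum.trans (by gcongr)

end

/-! ### Explicit bounds in terms of the rate -/

/-- With r = √(2πk b²/σ²) and y = k(σ² + b²)/((k - 1)σ²), the difference of inverse roots is (√y -
1)/r. The bound √y ≤ (1 + y)/2 leaves (y - 1)/(2r), which is the rate without its expectation factor
times a correction tending to 1 when k and k b²/σ² tend to infinity. -/
lemma inv_sqrt_sub_inv_sqrt_le {k : ℕ} (hk : 2 ≤ k) {σ b : ℝ} (hσ : 0 < σ) (hb : b ≠ 0) :
    ((Real.sqrt (2 * Real.pi * (((k - 1 : ℕ) * b ^ 2) / (σ ^ 2 + b ^ 2))))⁻¹ -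
        (Real.sqrt (2 * Real.pi * (((k - 1 : ℕ) * b ^ 2 + b ^ 2) / σ ^ 2)))⁻¹) * meanWLogOdds ≤
      oneBitRate k σ b * ((1 + (k * (b ^ 2 / σ ^ 2))⁻¹) * (k / ((k : ℝ) - 1))) := by
  have hcast : ((k - 1 : ℕ) : ℝ) = (k : ℝ) - 1 := by rw [Nat.cast_sub (by omega)]; simp
  have hk1 : (0 : ℝ) < (k : ℝ) - 1 := by
    have : (2 : ℝ) ≤ k := by exact_mod_cast hk
    linarith
  have hk0 : (0 : ℝ) < k := by linarith
  have hb2 : 0 < b ^ 2 := by positivity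
  set r := Real.sqrt (2 * Real.pi * k * (b ^ 2 / σ ^ 2))
  have hr : 0 < r := Real.sqrt_pos.2 (by positivity)
  set y := k * (σ ^ 2 + b ^ 2) / (((k : ℝ) - 1) * σ ^ 2)
  have hy : 0 < y := by positivity
  have e1 : Real.sqrt (2 * Real.pi * (((k - 1 : ℕ) * b ^ 2 + b ^ 2) / σ ^ 2)) = r := by
    rw [hcast]
    congr 1
    field_simp
    ring
  have e2 : (Real.sqrt (2 * Real.pi * (((k - 1 : ℕ) * b ^ 2) / (σ ^ 2 + b ^ 2))))⁻¹ =
      r⁻¹ * Real.sqrt y := by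
    rw [hcast, ← Real.sqrt_inv, ← Real.sqrt_inv, ← Real.sqrt_mul (by positivity)]
    congr 1
    simp only [y]
    field_simp
  have hsq : Real.sqrt y ≤ (1 + y) / 2 := by
    nlinarith [Real.sq_sqrt hy.le, sq_nonneg (Real.sqrt y - 1)]
  have e3 : oneBitRate k σ b * ((1 + (k * (b ^ 2 / σ ^ 2))⁻¹) * (k / ((k : ℝ) - 1))) =
      r⁻¹ * ((y - 1) / 2) * meanWLogOdds := by
    have h : oneBitRate k σ b = 1 / 2 * ((b ^ 2 / σ ^ 2) / r) * meanWLogOdds := rfl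
    rw [h]
    simp only [y]
    field_simp
    ring
  rw [e1, e2, e3]
  refine mul_le_mul_of_nonneg_right ?_ meanWLogOdds_pos.le
  have := mul_le_mul_of_nonneg_left hsq (inv_pos.2 hr).le
  linarith

/-- Since 1/σ - 1/τ = b²/(στ(τ + σ)) ≤ b²/(2σ³), the contribution of the revealed columns is at most
b²/σ² times k(b²/σ²)²/4, and the hypothesis makes the last factor at most 1. -/
lemma meanGapVar_le {k : ℕ} {σ b : ℝ} (hσ : 0 < σ)
    (h : k * (b ^ 2 / σ ^ 2) * (b ^ 2 / σ ^ 2) ≤ 4) :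
    meanGapVar ((k - 1 : ℕ) * b ^ 2) σ b ≤ 2 * (b ^ 2 / σ ^ 2) := by
  set τ := Real.sqrt (σ ^ 2 + b ^ 2)
  have hτ2 : τ ^ 2 = σ ^ 2 + b ^ 2 := Real.sq_sqrt (by positivity)
  have hστ : σ ≤ τ := Real.le_sqrt_of_sq_le (by nlinarith [sq_nonneg b])
  have hτ : 0 < τ := hσ.trans_le hστ
  have hD0 : 0 ≤ σ⁻¹ - τ⁻¹ := sub_nonneg.2 (inv_anti₀ hσ hστ)
  have hD : σ⁻¹ - τ⁻¹ ≤ b ^ 2 / (2 * σ ^ 3) := by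
    have e : σ⁻¹ - τ⁻¹ = b ^ 2 / (σ * τ * (τ + σ)) := by
      rw [show b ^ 2 = τ ^ 2 - σ ^ 2 by rw [hτ2]; ring]
      field_simp
      ring
    rw [e]
    refine div_le_div_of_nonneg_left (sq_nonneg b) (by positivity) ?_
    calc 2 * σ ^ 3 = σ * σ * (σ + σ) := by ring
      _ ≤ σ * τ * (τ + σ) := by gcongr
  have hk : ((k - 1 : ℕ) : ℝ) ≤ k := by exact_mod_cast Nat.sub_le k 1
  unfold meanGapVar
  calc (σ⁻¹ - τ⁻¹) ^ 2 * ((k - 1 : ℕ) * b ^ 2) + (b / σ) ^ 2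
      ≤ (b ^ 2 / (2 * σ ^ 3)) ^ 2 * (k * b ^ 2) + (b / σ) ^ 2 := by gcongr
    _ = (b ^ 2 / σ ^ 2) * ((k * (b ^ 2 / σ ^ 2) * (b ^ 2 / σ ^ 2)) / 4 + 1) := by
        field_simp
        ring
    _ ≤ (b ^ 2 / σ ^ 2) * (4 / 4 + 1) := by gcongr
    _ = _ := by ring

lemma oneBitErrorProb_le_one {p n k : ℕ} {dec : SupportDecoder p n} (hdec : Measurable dec)
    (hk : k ≤ p) (σ b : ℝ) : oneBitErrorProb k σ b dec ≤ 1 := by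
  rw [oneBitErrorProb_eq hdec hk]
  have : 0 ≤ (∑ S ∈ Finset.powersetCard k Finset.univ,
      (designNoiseLaw p n σ).real (decodeEvent b dec S S)) / (p.choose k : ℕ) := by positivity
  linarith

lemma oneBitRate_pos {k : ℕ} (hk : 0 < k) {σ b : ℝ} (hσ : 0 < σ) (hb : b ≠ 0) :
    0 < oneBitRate k σ b := by
  have := meanWLogOdds_pos
  unfold oneBitRate
  positivity

/-- The non-asymptotic converse in terms of `oneBitRate`. -/
lemma one_sub_oneBitErrorProb_le_of_rate {p n k : ℕ} {dec : SupportDecoder p n}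
    (hdec : Measurable dec) (hk2 : 2 ≤ k) (hk : k ≤ p) {σ b : ℝ} (hσ : 0 < σ) (hb : b ≠ 0)
    (h8 : b ^ 2 / σ ^ 2 ≤ 1 / 8) (h4 : k * (b ^ 2 / σ ^ 2) * (b ^ 2 / σ ^ 2) ≤ 4) {γ N R ε : ℝ}
    (hN : n ≤ N) (hR : (1 + (k * (b ^ 2 / σ ^ 2))⁻¹) * (k / ((k : ℝ) - 1)) ≤ R)
    (hε : 0 < ε) (hγ : N * oneBitRate k σ b * R + ε ≤ γ) :
    1 - oneBitErrorProb k σ b dec ≤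
      4 * (N * (b ^ 2 / σ ^ 2) / ε ^ 2) + Real.exp (γ - Real.log ((p : ℝ) - k + 1)) := by
  have hcast : ((k - 1 : ℕ) : ℝ) = (k : ℝ) - 1 := by rw [Nat.cast_sub (by omega)]; simp
  have hk1 : (0 : ℝ) < (k : ℝ) - 1 := by
    have : (2 : ℝ) ≤ k := by exact_mod_cast hk2
    linarith
  have hp : (0 : ℝ) < (p : ℝ) - k + 1 := by
    have : (k : ℝ) ≤ p := by exact_mod_cast hk
    linarith
  have hV : (0 : ℝ) < ((k - 1 : ℕ) : ℝ) * b ^ 2 := by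
    rw [hcast]
    positivity
  have hgap := meanGapVar_le (k := k) hσ h4
  have hgap4 : meanGapVar ((k - 1 : ℕ) * b ^ 2) σ b ≤ 1 / 4 := by linarith
  have hVc := Real.coe_toNNReal _ hV.le
  have hrate := oneBitRate_pos (show 0 < k by omega) hσ hb
  have hint := integral_sampleDensity_le hσ hb (Real.toNNReal_pos.2 hV) (by rwa [hVc])
  rw [hVc] at hint
  have hm := hint.trans ((inv_sqrt_sub_inv_sqrt_le hk2 hσ hb).trans
    (mul_le_mul_of_nonneg_left hR hrate.le))
  have hR0 : 0 < R := lt_of_lt_of_le (by positivity) hR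
  have hnm : n * (oneBitRate k σ b * R) ≤ N * oneBitRate k σ b * R := by
    rw [mul_assoc]
    gcongr
  have hN0 : 0 ≤ N := (Nat.cast_nonneg n).trans hN
  refine (one_sub_oneBitErrorProb_le hdec (by omega) hk hσ hb hgap4 hm
    (by linarith : n * (oneBitRate k σ b * R) < γ)).trans ?_
  rw [Real.exp_sub, Real.exp_log hp]
  refine add_le_add_left ?_ _
  have h0 : 0 ≤ meanGapVar ((k - 1 : ℕ) * b ^ 2) σ b := by unfold meanGapVar; positivity
  calc n * (2 * meanGapVar ((k - 1 : ℕ) * b ^ 2) σ b) / (γ - n * (oneBitRate k σ b * R)) ^ 2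
      ≤ N * (2 * (2 * (b ^ 2 / σ ^ 2))) / ε ^ 2 := by
        gcongr
        linarith
    _ = _ := by ring

/-! ### Asymptotics -/

lemma tendsto_log_natCast : Tendsto (fun p : ℕ => Real.log (p : ℝ)) atTop atTop :=
  Real.tendsto_log_atTop.comp tendsto_natCast_atTop_atTop

lemma tendsto_log_pow_div_natCast (m : ℕ) :
    Tendsto (fun p : ℕ => Real.log (p : ℝ) ^ m / (p : ℝ)) atTop (𝓝 0) := by
  have h := (Real.isLittleO_pow_log_id_atTop (n := m)).tendsto_div_nhds_zero
  exact h.comp tendsto_natCast_atTop_atTop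

section
variable {k : ℕ → ℕ} {σ b₀ : ℕ → ℝ}

lemma isTheta_snr (hσ : (fun p : ℕ => σ p ^ 2) =Θ[atTop] (fun _ : ℕ => (1 : ℝ)))
    (hb : (fun p : ℕ => b₀ p ^ 2) =Θ[atTop] (fun p : ℕ => Real.log (p : ℝ) / (p : ℝ))) :
    (fun p => b₀ p ^ 2 / σ p ^ 2) =Θ[atTop] fun p : ℕ => Real.log (p : ℝ) / (p : ℝ) := by
  simpa using hb.div hσ

lemma isTheta_card_mul_snr (hk : (fun p : ℕ => (k p : ℝ)) =Θ[atTop] (fun p : ℕ => (p : ℝ)))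
    (hσ : (fun p : ℕ => σ p ^ 2) =Θ[atTop] (fun _ : ℕ => (1 : ℝ)))
    (hb : (fun p : ℕ => b₀ p ^ 2) =Θ[atTop] (fun p : ℕ => Real.log (p : ℝ) / (p : ℝ))) :
    (fun p => k p * (b₀ p ^ 2 / σ p ^ 2)) =Θ[atTop] fun p : ℕ => Real.log (p : ℝ) := by
  refine (hk.mul (isTheta_snr hσ hb)).trans_eventuallyEq ?_
  filter_upwards [eventually_gt_atTop 0] with p hp
  have : (p : ℝ) ≠ 0 := by positivity
  field_simp

/-- The rate is a constant times (b₀²/σ²)/√(k b₀²/σ²), so the quotient has order log p · √(log p) /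
(log p / p). -/
lemma isTheta_log_div_oneBitRate {η : ℝ} (hη : η ∈ Set.Ioo (0 : ℝ) 1)
    (hk : (fun p : ℕ => (k p : ℝ)) =Θ[atTop] (fun p : ℕ => (p : ℝ)))
    (hσ : (fun p : ℕ => σ p ^ 2) =Θ[atTop] (fun _ : ℕ => (1 : ℝ)))
    (hb : (fun p : ℕ => b₀ p ^ 2) =Θ[atTop] (fun p : ℕ => Real.log (p : ℝ) / (p : ℝ))) :
    (fun p : ℕ => Real.log (p : ℝ) / oneBitRate (k p) (σ p) (b₀ p) * (1 - η)) =Θ[atTop]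
      (fun p : ℕ => (p : ℝ) * Real.sqrt (Real.log (p : ℝ))) := by
  have hlog : ∀ᶠ p : ℕ in atTop, 0 < Real.log (p : ℝ) :=
    tendsto_log_natCast.eventually_gt_atTop 0
  have hs := (isTheta_card_mul_snr hk hσ hb).sqrt
    (Eventually.of_forall fun p => by positivity) (hlog.mono fun p hp => hp.le)
  have h := ((isTheta_refl (fun p : ℕ => Real.log (p : ℝ)) atTop).mul hs).div (isTheta_snr hσ hb)
  have hG := meanWLogOdds_pos
  have hη1 : 0 < 1 - η := by linarith [hη.2]
  have hC : (1 - η) * (2 * Real.sqrt (2 * Real.pi)) / meanWLogOdds ≠ 0 := by positivity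
  have h2 := (isTheta_const_mul_left hC).2 h
  have e1 : (fun p : ℕ => Real.log (p : ℝ) / oneBitRate (k p) (σ p) (b₀ p) * (1 - η)) =
      fun p : ℕ => (1 - η) * (2 * Real.sqrt (2 * Real.pi)) / meanWLogOdds *
        (Real.log (p : ℝ) * Real.sqrt (k p * (b₀ p ^ 2 / σ p ^ 2)) / (b₀ p ^ 2 / σ p ^ 2)) := by
    ext p
    have e : Real.sqrt (2 * Real.pi * k p * (b₀ p ^ 2 / σ p ^ 2)) =
        Real.sqrt (2 * Real.pi) * Real.sqrt (k p * (b₀ p ^ 2 / σ p ^ 2)) := by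
      rw [← Real.sqrt_mul (by positivity)]
      congr 1
      ring
    rw [oneBitRate, e]
    -- Written with inverses, the identity holds for every p, including those where b₀ or k vanishes
    -- and a division by zero occurs.
    simp only [div_eq_mul_inv, mul_inv, inv_inv, one_mul]
    ring
  rw [e1]
  refine h2.trans_eventuallyEq ?_
  filter_upwards [eventually_gt_atTop 0, hlog] with p hp hl
  have : (p : ℝ) ≠ 0 := by positivity
  field_simp

/-- The slack η log p is split: the mean of the density sum is at most (1 - 3η/4) log p, Chebyshev's
inequality uses a margin (η/4) log p, and γ = (1 - η/2) log p stays (η/2) log p below log p. -/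
lemma tendsto_oneBitErrorProb {η : ℝ} (hη : η ∈ Set.Ioo (0 : ℝ) 1)
    (hσ_pos : ∀ p, 0 < σ p) (hk_le : ∀ p, k p ≤ p)
    (hk : (fun p : ℕ => (k p : ℝ)) =Θ[atTop] (fun p : ℕ => (p : ℝ)))
    (hk_log : (fun p : ℕ => Real.log ((p : ℝ) - (k p : ℝ) + 1)) ~[atTop]
      (fun p : ℕ => Real.log (p : ℝ)))
    (hσ : (fun p : ℕ => σ p ^ 2) =Θ[atTop] (fun _ : ℕ => (1 : ℝ)))
    (hb : (fun p : ℕ => b₀ p ^ 2) =Θ[atTop] (fun p : ℕ => Real.log (p : ℝ) / (p : ℝ)))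
    {n : ℕ → ℕ} (hn : ∀ᶠ p : ℕ in atTop,
      (n p : ℝ) ≤ Real.log (p : ℝ) / oneBitRate (k p) (σ p) (b₀ p) * (1 - η))
    {dec : (p : ℕ) → SupportDecoder p (n p)} (hdec : ∀ p, Measurable (dec p)) :
    Tendsto (fun p : ℕ => oneBitErrorProb (k p) (σ p) (b₀ p) (dec p)) atTop (𝓝 1) := by
  have hη0 := hη.1
  have hη1 := hη.2
  have hlog := tendsto_log_natCast
  have hsnr := isTheta_snr hσ hb
  have hksnr := isTheta_card_mul_snr hk hσ hb
  have hsnr0 : Tendsto (fun p => b₀ p ^ 2 / σ p ^ 2) atTop (𝓝 0) :=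
    hsnr.1.trans_tendsto (by simpa using tendsto_log_pow_div_natCast 1)
  have hkss0 : Tendsto (fun p => k p * (b₀ p ^ 2 / σ p ^ 2) * (b₀ p ^ 2 / σ p ^ 2)) atTop (𝓝 0) :=
    (hksnr.mul hsnr).1.trans_tendsto
      ((tendsto_log_pow_div_natCast 2).congr fun p => by ring)
  -- Functions of the same order eventually have the same zeros, and log p / p is eventually
  -- positive.
  have hb0 : ∀ᶠ p in atTop, b₀ p ≠ 0 := by
    filter_upwards [hb.eq_zero_iff, hlog.eventually_gt_atTop 0, eventually_gt_atTop 0]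
      with p hp hl hp0 h
    rw [h] at hp
    have h2 : Real.log (p : ℝ) / p = 0 := hp.1 (by simp)
    have : 0 < Real.log (p : ℝ) / p := by positivity
    linarith
  have hk_top : Tendsto (fun p => (k p : ℝ)) atTop atTop := by
    have h := (hk.tendsto_norm_atTop_iff).2
      (tendsto_norm_atTop_atTop.comp tendsto_natCast_atTop_atTop)
    refine h.congr fun p => ?_
    rw [Function.comp_apply, Real.norm_eq_abs, abs_of_nonneg (by positivity)]
  have hks_top : Tendsto (fun p => k p * (b₀ p ^ 2 / σ p ^ 2)) atTop atTop := by
    have h := (hksnr.tendsto_norm_atTop_iff).2 (tendsto_norm_atTop_atTop.comp hlog)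
    refine h.congr fun p => ?_
    rw [Function.comp_apply, Real.norm_eq_abs, abs_of_nonneg (by positivity)]
  have hR : Tendsto (fun p => (1 + (k p * (b₀ p ^ 2 / σ p ^ 2))⁻¹) * (k p / ((k p : ℝ) - 1)))
      atTop (𝓝 1) := by
    have h1 := (tendsto_inv_atTop_zero.comp hks_top).const_add 1
    have h2 : Tendsto (fun p => 1 + ((k p : ℝ) - 1)⁻¹) atTop (𝓝 (1 + 0)) :=
      (tendsto_inv_atTop_zero.comp (tendsto_atTop_add_const_right _ (-1) hk_top)).const_add 1
    have h3 : Tendsto (fun p => (k p : ℝ) / ((k p : ℝ) - 1)) atTop (𝓝 (1 + 0)) := by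
      refine h2.congr' ?_
      filter_upwards [hk_top.eventually_gt_atTop 1] with p hp
      have : (k p : ℝ) - 1 ≠ 0 := by linarith
      field_simp
      ring
    simpa using h1.mul h3
  -- Since R > 1, it eventually absorbs the correction factor of the rate; its value turns (1 - η)
  -- log p into (1 - 3η/4) log p.
  set R := (1 - 3 * η / 4) / (1 - η)
  have hR1 : 1 < R := by
    rw [lt_div_iff₀ (by linarith)]
    linarith
  set N : ℕ → ℝ := fun p => Real.log (p : ℝ) / oneBitRate (k p) (σ p) (b₀ p) * (1 - η)
  -- The Chebyshev term: p √(log p) · (log p / p) / (log p)² = 1/√(log p).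
  have hNlim : Tendsto (fun p : ℕ => N p * (b₀ p ^ 2 / σ p ^ 2) /
      (η / 4 * Real.log (p : ℝ)) ^ 2) atTop (𝓝 0) := by
    have hc : (fun p : ℕ => (η / 4 * Real.log (p : ℝ)) ^ 2) =Θ[atTop]
        fun p : ℕ => Real.log (p : ℝ) ^ 2 := by
      simp_rw [mul_pow]
      exact (isTheta_const_mul_left (by positivity)).2 (isTheta_refl _ _)
    refine (((isTheta_log_div_oneBitRate hη hk hσ hb).mul hsnr).div hc).1.trans_tendsto ?_
    have h := tendsto_inv_atTop_zero.comp (Real.tendsto_sqrt_atTop.comp hlog)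
    refine h.congr' ?_
    filter_upwards [eventually_gt_atTop 0, hlog.eventually_gt_atTop 0] with p hp hl
    have hp' : (p : ℝ) ≠ 0 := by positivity
    have hs := Real.sqrt_pos.2 hl
    simp only [Function.comp_apply]
    rw [inv_eq_one_div, div_eq_div_iff hs.ne' (by positivity)]
    have := Real.mul_self_sqrt hl.le
    field_simp
    nlinarith
  -- By `hk_log` the exponent is (-η/2 + o(1)) log p.
  have hexp : Tendsto (fun p : ℕ => Real.exp ((1 - η / 2) * Real.log (p : ℝ) -
      Real.log ((p : ℝ) - k p + 1))) atTop (𝓝 0) := by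
    refine Real.tendsto_exp_atBot.comp ?_
    have h := (isEquivalent_iff_tendsto_one (hlog.eventually_ne_atTop 0)).1 hk_log
    have h2 : Tendsto (fun p : ℕ => (1 - η / 2) - Real.log ((p : ℝ) - k p + 1) / Real.log (p : ℝ))
        atTop (𝓝 (1 - η / 2 - 1)) := h.const_sub _
    refine (h2.neg_mul_atTop (by linarith) hlog).congr' ?_
    filter_upwards [hlog.eventually_gt_atTop 0] with p hl
    field_simp
  have hbound : ∀ᶠ p : ℕ in atTop, 1 - (4 * (N p * (b₀ p ^ 2 / σ p ^ 2) /
      (η / 4 * Real.log (p : ℝ)) ^ 2) + Real.exp ((1 - η / 2) * Real.log (p : ℝ) -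
      Real.log ((p : ℝ) - k p + 1))) ≤ oneBitErrorProb (k p) (σ p) (b₀ p) (dec p) := by
    filter_upwards [hn, hb0, hk_top.eventually_ge_atTop 2, hlog.eventually_gt_atTop 0,
      hsnr0.eventually_le_const (show (0 : ℝ) < 1 / 8 by norm_num),
      hkss0.eventually_le_const (show (0 : ℝ) < 4 by norm_num),
      hR.eventually_le_const hR1] with p h1 h2 h3 h4 h5 h6 h7
    have hk2 : 2 ≤ k p := by exact_mod_cast h3
    have hrate := oneBitRate_pos (show 0 < k p by omega) (hσ_pos p) h2
    have hγ : N p * oneBitRate (k p) (σ p) (b₀ p) * R + η / 4 * Real.log (p : ℝ) ≤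
        (1 - η / 2) * Real.log (p : ℝ) := by
      have e : N p * oneBitRate (k p) (σ p) (b₀ p) * R = (1 - 3 * η / 4) * Real.log (p : ℝ) := by
        have : 1 - η ≠ 0 := by linarith
        simp only [N, R]
        field_simp
      rw [e]
      linarith
    have := one_sub_oneBitErrorProb_le_of_rate (hdec p) hk2 (hk_le p) (hσ_pos p) h2 h5 h6
      (N := N p) (R := R) h1 h7 (by positivity) hγ
    linarith
  have hlim := ((hNlim.const_mul 4).add hexp).const_sub 1
  simp only [mul_zero, add_zero, sub_zero] at hlim
  exact tendsto_of_tendsto_of_tendsto_of_le_of_le' hlim tendsto_const_nhds hbound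
    (Eventually.of_forall fun p => oneBitErrorProb_le_one (hdec p) (hk_le p) _ _)

end

theorem corollary4 (k : ℕ → ℕ) (σ b₀ : ℕ → ℝ) (η : ℝ) (hη : η ∈ Set.Ioo (0 : ℝ) 1)
    (hσ_pos : ∀ p, 0 < σ p)
    (hk_le : ∀ p, k p ≤ p)
    (hk : (fun p : ℕ => (k p : ℝ)) =Θ[atTop] (fun p : ℕ => (p : ℝ)))
    (hk_log : (fun p : ℕ => Real.log ((p : ℝ) - (k p : ℝ) + 1)) ~[atTop]
      (fun p : ℕ => Real.log (p : ℝ)))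
    (hσ : (fun p : ℕ => σ p ^ 2) =Θ[atTop] (fun _ : ℕ => (1 : ℝ)))
    (hb : (fun p : ℕ => b₀ p ^ 2) =Θ[atTop] (fun p : ℕ => Real.log (p : ℝ) / (p : ℝ))) :
    Integrable wLogOdds (gaussianReal 0 1) ∧
    (fun p : ℕ => Real.log (p : ℝ) / oneBitRate (k p) (σ p) (b₀ p) * (1 - η)) =Θ[atTop]
      (fun p : ℕ => (p : ℝ) * Real.sqrt (Real.log (p : ℝ))) ∧
    ∀ n : ℕ → ℕ,
      (∀ᶠ p : ℕ in atTop,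
        (n p : ℝ) ≤ Real.log (p : ℝ) / oneBitRate (k p) (σ p) (b₀ p) * (1 - η)) →
      ∀ dec : (p : ℕ) → SupportDecoder p (n p), (∀ p, Measurable (dec p)) →
        Tendsto (fun p : ℕ => oneBitErrorProb (k p) (σ p) (b₀ p) (dec p)) atTop (𝓝 1) := by
  exact ⟨integrable_wLogOdds, isTheta_log_div_oneBitRate hη hk hσ hb, fun _ hn _ hdec =>
    tendsto_oneBitErrorProb hη hσ_pos hk_le hk hk_log hσ hb hn hdec⟩
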